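/- Let $(M,g)$ be a spacetime: a smooth 4-manifold with a smooth Lorentz metric of signature $(-1,1,1,1)$ and Levi-Civita connection $\nabla$. Let $F$ be a smooth 2-form on $M$ that is - a force-free electromagnetic field: $dF=0$ and $F(j^\sharp,\cdot)=0$, where $j=*\,d*F$; - null: $F_{\mu\nu}F^{\mu\nu}=0$ everywhere; - such that $\ker F=\{v : F(v,\cdot)=0\}$ is 2-dimensional at every point (that is, $F$ is nowhere zero and pointwise simple, $F=\alpha\wedge\beta$). Then $\ker F$ is a smooth involutive distribution of planes on which $g$ is degenerate; that is, $\ker F$ consists of the tangent planes of a null foliation $\mathcal F$, whose leaves, the field sheets, are the integral surfaces of $\ker F$. Moreover every point of $M$ has an open neighbourhood $U$ carrying a smooth vector field $l$ such that 1. $l$ is a null geodesic vector field: $l$ is nowhere zero, $g(l,l)=0$ and $\nabla_l l=0$ on $U$; 2. $l$ is tangent to the field sheets: $l_x\in\ker F_x$ for all $x\in U$, so $l$ is tangent to every integral surface of $\ker F$ within $U$; 3. $\mathcal F$ admits an equipartition of null mean curvature with respect to $l$ on $U$. Here a null foliation adapted frame containing $l$, on an open set $V\subseteq U$, is a smooth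 frame $(s,l,\alpha^\sharp,n)$ such that $s,l$ span $\ker F$, $g(s,s)=g(\alpha^\sharp,\alpha^\sharp)=1$, $g(l,l)=g(n,n)=0$, $g(l,n)=-1$, and all other inner products among the four fields vanish. The null mean curvature is $$\theta=\tfrac12\big[g(\nabla_s l,s)+g(\nabla_{\alpha^\sharp}l,\alpha^\sharp)\big].$$ Statement 3 means that an adapted frame containing $l$ exists on $U$, and that in every adapted frame containing $l$ on an open set $V\subseteq U$ one has $\theta=g(\nabla_s l,s)$ on $V$. -/

import Mathlib

open scoped Manifold ContDiff Topology

noncomputable section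

namespace NullFF

/-- The model space `ℝ⁴` of spacetime. -/
abbrev E4 : Type := EuclideanSpace ℝ (Fin 4)

/-! ### Metric, Hodge star, current and Christoffel symbols in coordinates -/

section Coordinates

/-- The coordinate basis vector `∂ᵢ`. -/
def basisVec (i : Fin 4) : E4 := EuclideanSpace.single i (1 : ℝ)

/-- The musical map `♯` of a bilinear form `B`: the vector `v` with `B v = θ`. -/
def sharp (B : E4 →L[ℝ] E4 →L[ℝ] ℝ) (θ : E4 →L[ℝ] ℝ) : E4 := B.inverse θ

/-- The vector `(dxⁱ)♯`, with components `g^{i j}`. -/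
def raisedVec (B : E4 →L[ℝ] E4 →L[ℝ] ℝ) (i : Fin 4) : E4 :=
  sharp B (EuclideanSpace.proj i)

/-- The coordinate `4`-form `dx¹ ∧ dx² ∧ dx³ ∧ dx⁴`. -/
def coordDet : E4 [⋀^Fin 4]→L[ℝ] ℝ :=
  { (EuclideanSpace.basisFun (Fin 4) ℝ).toBasis.det with
    cont := by
      change Continuous fun v : Fin 4 → E4 =>
        (EuclideanSpace.basisFun (Fin 4) ℝ).toBasis.det v
      simp only [Module.Basis.det_apply]
      refine Continuous.matrix_det ?_
      refine continuous_matrix fun i j => ?_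
      simp only [Module.Basis.toMatrix_apply, OrthonormalBasis.coe_toBasis_repr_apply,
        EuclideanSpace.basisFun_repr]
      fun_prop }

/-- The metric volume form `√|det g| dx¹ ∧ dx² ∧ dx³ ∧ dx⁴`. -/
def volForm (B : E4 →L[ℝ] E4 →L[ℝ] ℝ) : E4 [⋀^Fin 4]→L[ℝ] ℝ :=
  √|(Matrix.of fun i j : Fin 4 => B (basisVec i) (basisVec j)).det| • coordDet

/-- The Hodge star of a `2`-form: `(*w)_{kl} = (1/2!) w^{ij} ε_{ijkl}`. -/
def hodge2 (B : E4 →L[ℝ] E4 →L[ℝ] ℝ) (w : E4 [⋀^Fin 2]→L[ℝ] ℝ) : E4 [⋀^Fin 2]→L[ℝ] ℝ :=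
  (1 / 2 : ℝ) • ∑ i : Fin 4, ∑ j : Fin 4,
    w ![raisedVec B i, raisedVec B j] •
      ((volForm B).curryLeft (basisVec i)).curryLeft (basisVec j)

/-- The Hodge star of a `3`-form: `(*η)_l = (1/3!) η^{ijk} ε_{ijkl}`. -/
def hodge3 (B : E4 →L[ℝ] E4 →L[ℝ] ℝ) (η : E4 [⋀^Fin 3]→L[ℝ] ℝ) : E4 [⋀^Fin 1]→L[ℝ] ℝ :=
  (1 / 6 : ℝ) • ∑ i : Fin 4, ∑ j : Fin 4, ∑ k : Fin 4,
    η ![raisedVec B i, raisedVec B j, raisedVec B k] •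
      (((volForm B).curryLeft (basisVec i)).curryLeft (basisVec j)).curryLeft (basisVec k)

/-- The current density `j = * d * F` of a `2`-form `F` for the metric `G`, in coordinates. -/
def current (G : E4 → E4 →L[ℝ] E4 →L[ℝ] ℝ) (F : E4 → E4 [⋀^Fin 2]→L[ℝ] ℝ) (y : E4) :
    E4 →L[ℝ] ℝ :=
  (ContinuousAlternatingMap.ofSubsingleton ℝ E4 ℝ (0 : Fin 1)).symm
    (hodge3 (G y) (extDeriv (fun z => hodge2 (G z) (F z)) y))

/-- The invariant `F² = F_{μν} F^{μν}`. -/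
def fieldSq (B : E4 →L[ℝ] E4 →L[ℝ] ℝ) (w : E4 [⋀^Fin 2]→L[ℝ] ℝ) : ℝ :=
  ∑ i : Fin 4, ∑ j : Fin 4,
    w ![basisVec i, basisVec j] * w ![raisedVec B i, raisedVec B j]

/-- The Christoffel symbols `Γ(u, v)`, given by
`g(Γ(u, v), z) = ½ (∂_u g(v, z) + ∂_v g(u, z) - ∂_z g(u, v))` for constant `u`, `v`, `z`. -/
def christoffel (G : E4 → E4 →L[ℝ] E4 →L[ℝ] ℝ) (y u v : E4) : E4 :=
  sharp (G y) ((1 / 2 : ℝ) •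
    (fderiv ℝ G y u v + fderiv ℝ G y v u - ((fderiv ℝ G y).flip u).flip v))

end Coordinates

/-! ### Tensor fields on spacetime -/

section Manifold

variable {M : Type*} [TopologicalSpace M] [ChartedSpace E4 M]

/-- The differential at `y` of the inverse of the chart at `x₀`. -/
def chartFrame (x₀ : M) (y : E4) :
    E4 →L[ℝ] TangentSpace (𝓡 4) ((extChartAt (𝓡 4) x₀).symm y) :=
  mfderiv 𝓘(ℝ, E4) (𝓡 4) (extChartAt (𝓡 4) x₀).symm y

/-- A field of bilinear forms in the coordinates of the chart at `x₀`. -/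
def coordBilin (g : ∀ x : M, TangentSpace (𝓡 4) x →L[ℝ] TangentSpace (𝓡 4) x →L[ℝ] ℝ)
    (x₀ : M) (y : E4) : E4 →L[ℝ] E4 →L[ℝ] ℝ :=
  (ContinuousLinearMap.precomp ℝ (chartFrame x₀ y)) ∘L
    (g ((extChartAt (𝓡 4) x₀).symm y)) ∘L (chartFrame x₀ y)

/-- A `2`-form in the coordinates of the chart at `x₀`. -/
def coordForm (F : ∀ x : M, TangentSpace (𝓡 4) x [⋀^Fin 2]→L[ℝ] ℝ)
    (x₀ : M) (y : E4) : E4 [⋀^Fin 2]→L[ℝ] ℝ :=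
  (F ((extChartAt (𝓡 4) x₀).symm y)).compContinuousLinearMap (chartFrame x₀ y)

/-- A vector field in the coordinates of the chart at `x₀`. -/
def coordField (X : ∀ x : M, TangentSpace (𝓡 4) x) (x₀ : M) (y : E4) : E4 :=
  VectorField.mpullback 𝓘(ℝ, E4) (𝓡 4) (extChartAt (𝓡 4) x₀).symm X y

variable (M) in
/-- A smooth metric of signature `(-1, 1, 1, 1)`. -/
structure LorentzMetric where
  /-- The value of the metric at a point. -/
  val : ∀ x : M, TangentSpace (𝓡 4) x →L[ℝ] TangentSpace (𝓡 4) x →L[ℝ] ℝ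
  symm : ∀ (x : M) (v w : TangentSpace (𝓡 4) x), val x v w = val x w v
  signature : ∀ x : M, ∃ b : Module.Basis (Fin 4) ℝ (TangentSpace (𝓡 4) x),
    ∀ i j, val x (b i) (b j) = if i = j then (if i = 0 then -1 else 1) else 0
  smooth : ∀ x₀ : M, ContDiffOn ℝ ∞ (coordBilin val x₀) (extChartAt (𝓡 4) x₀).target

/-- Smoothness of a vector field on a set. -/
def SmoothFieldOn [IsManifold (𝓡 4) ∞ M] (X : ∀ x : M, TangentSpace (𝓡 4) x) (U : Set M) : Prop :=
  ContMDiffOn (𝓡 4) (𝓡 4).tangent ∞ (fun x => (⟨x, X x⟩ : TangentBundle (𝓡 4) M)) U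

/-- The Levi-Civita derivative `∇_X Y`: in the chart at `x` it is
`X^i ∂_i Y^k + Γ^k_{ij} X^i Y^j`. -/
def covDeriv (g : LorentzMetric M) (X Y : ∀ x : M, TangentSpace (𝓡 4) x) (x : M) :
    TangentSpace (𝓡 4) x :=
  VectorField.mpullback (𝓡 4) 𝓘(ℝ, E4) (extChartAt (𝓡 4) x)
    (fun y : E4 => (fderiv ℝ (coordField Y x) y (coordField X x y) +
      christoffel (coordBilin g.val x) y (coordField X x y) (coordField Y x y) : E4)) x

/-! ### Force-free fields -/

/-- A force-free electromagnetic field: a smooth closed `2`-form `F` whose current `j = * d * F`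
satisfies `i_{j♯} F = 0`; all of it in every chart.
(Reversing the orientation does not change `j`, as it contains two stars.) -/
structure IsForceFree (g : LorentzMetric M)
    (F : ∀ x : M, TangentSpace (𝓡 4) x [⋀^Fin 2]→L[ℝ] ℝ) : Prop where
  smooth : ∀ x₀ : M, ContDiffOn ℝ ∞ (coordForm F x₀) (extChartAt (𝓡 4) x₀).target
  closed : ∀ x₀ : M, ∀ y ∈ (extChartAt (𝓡 4) x₀).target, extDeriv (coordForm F x₀) y = 0
  force_free : ∀ x₀ : M, ∀ y ∈ (extChartAt (𝓡 4) x₀).target, ∀ v : E4,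
    coordForm F x₀ y
      ![sharp (coordBilin g.val x₀ y) (current (coordBilin g.val x₀) (coordForm F x₀) y), v] = 0

/-- `F` is null: `F² = F_{μν} F^{μν}` vanishes everywhere. -/
def IsNullField (g : LorentzMetric M)
    (F : ∀ x : M, TangentSpace (𝓡 4) x [⋀^Fin 2]→L[ℝ] ℝ) : Prop :=
  ∀ x₀ : M, ∀ y ∈ (extChartAt (𝓡 4) x₀).target,
    fieldSq (coordBilin g.val x₀ y) (coordForm F x₀ y) = 0

/-- The kernel `{v | i_v F = 0}` of a `2`-form at a point. -/
def formKer (F : ∀ x : M, TangentSpace (𝓡 4) x [⋀^Fin 2]→L[ℝ] ℝ) (x : M) :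
    Submodule ℝ (TangentSpace (𝓡 4) x) where
  carrier := {v | ∀ w, F x ![v, w] = 0}
  add_mem' := by
    intro a b ha hb w
    have := (F x).map_vecCons_add ![w] a b
    simpa [ha w, hb w] using this
  zero_mem' := fun w => (F x).map_coord_zero (m := ![0, w]) 0 rfl
  smul_mem' := by
    intro c a ha w
    have := (F x).map_vecCons_smul ![w] c a
    simpa [ha w] using this

/-! ### Null foliations, described by their tangent planes -/

/-- `T` is the field of tangent planes of a null foliation: a smooth involutive distribution of
planes on which the metric is degenerate. -/
structure IsNullFoliation [IsManifold (𝓡 4) ∞ M] (g : LorentzMetric M)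
    (T : ∀ x : M, Submodule ℝ (TangentSpace (𝓡 4) x)) : Prop where
  rank : ∀ x, Module.finrank ℝ (T x) = 2
  smooth : ∀ p : M, ∃ U : Set M, IsOpen U ∧ p ∈ U ∧ ∃ X Y : ∀ x : M, TangentSpace (𝓡 4) x,
    SmoothFieldOn X U ∧ SmoothFieldOn Y U ∧ ∀ x ∈ U, T x = Submodule.span ℝ {X x, Y x}
  involutive : ∀ (U : Set M) (X Y : ∀ x : M, TangentSpace (𝓡 4) x), IsOpen U →
    SmoothFieldOn X U → SmoothFieldOn Y U → (∀ x ∈ U, X x ∈ T x ∧ Y x ∈ T x) →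
    ∀ x ∈ U, VectorField.mlieBracket (𝓡 4) X Y x ∈ T x
  degenerate : ∀ x, ∃ v ∈ T x, v ≠ 0 ∧ ∀ w ∈ T x, g.val x v w = 0

/-- `σ` on `W` parametrizes an integral surface of `T` (a piece of a leaf). -/
structure IsIntegralSurface (T : ∀ x : M, Submodule ℝ (TangentSpace (𝓡 4) x))
    (W : Set (EuclideanSpace ℝ (Fin 2))) (σ : EuclideanSpace ℝ (Fin 2) → M) : Prop where
  isOpen : IsOpen W
  smooth : ContMDiffOn (𝓡 2) (𝓡 4) ∞ σ W
  tangent : ∀ u ∈ W, (mfderiv (𝓡 2) (𝓡 4) σ u).range = T (σ u)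

/-- `(s, l, a, n)` is a null foliation adapted frame on `U`, where `a = α♯`. -/
structure IsAdaptedFrame [IsManifold (𝓡 4) ∞ M] (g : LorentzMetric M)
    (T : ∀ x : M, Submodule ℝ (TangentSpace (𝓡 4) x)) (U : Set M)
    (s l a n : ∀ x : M, TangentSpace (𝓡 4) x) : Prop where
  smooth_s : SmoothFieldOn s U
  smooth_l : SmoothFieldOn l U
  smooth_a : SmoothFieldOn a U
  smooth_n : SmoothFieldOn n U
  span : ∀ x ∈ U, T x = Submodule.span ℝ {s x, l x}
  ss : ∀ x ∈ U, g.val x (s x) (s x) = 1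
  aa : ∀ x ∈ U, g.val x (a x) (a x) = 1
  ll : ∀ x ∈ U, g.val x (l x) (l x) = 0
  nn : ∀ x ∈ U, g.val x (n x) (n x) = 0
  ln : ∀ x ∈ U, g.val x (l x) (n x) = -1
  ls : ∀ x ∈ U, g.val x (l x) (s x) = 0
  la : ∀ x ∈ U, g.val x (l x) (a x) = 0
  sa : ∀ x ∈ U, g.val x (s x) (a x) = 0
  ns : ∀ x ∈ U, g.val x (n x) (s x) = 0
  na : ∀ x ∈ U, g.val x (n x) (a x) = 0

/-- The null mean curvature `θ = ½ (g(∇_s l, s) + g(∇_a l, a))`. -/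
def nullMeanCurvature (g : LorentzMetric M) (s l a : ∀ x : M, TangentSpace (𝓡 4) x) (x : M) : ℝ :=
  (1 / 2 : ℝ) * (g.val x (covDeriv g s l x) (s x) + g.val x (covDeriv g a l x) (a x))

/-- On `U`, the foliation with tangent planes `T` admits an equipartition of null mean curvature
with respect to `l`: there are adapted frames containing `l`, and `θ = g(∇_s l, s)` in all of
them. -/
def AdmitsEquipartition [IsManifold (𝓡 4) ∞ M] (g : LorentzMetric M)
    (T : ∀ x : M, Submodule ℝ (TangentSpace (𝓡 4) x)) (U : Set M)
    (l : ∀ x : M, TangentSpace (𝓡 4) x) : Prop :=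
  (∃ s a n : ∀ x : M, TangentSpace (𝓡 4) x, IsAdaptedFrame g T U s l a n) ∧
  ∀ V ⊆ U, IsOpen V → ∀ s a n : ∀ x : M, TangentSpace (𝓡 4) x, IsAdaptedFrame g T V s l a n →
    ∀ x ∈ V, nullMeanCurvature g s l a x = g.val x (covDeriv g s l x) (s x)

/-- On `U`, `l` is a smooth null geodesic vector field: nowhere zero, `g(l, l) = 0` and
`∇_l l = 0`. -/
structure IsNullGeodesicField [IsManifold (𝓡 4) ∞ M] (g : LorentzMetric M) (U : Set M)
    (l : ∀ x : M, TangentSpace (𝓡 4) x) : Prop where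
  smooth : SmoothFieldOn l U
  ne_zero : ∀ x ∈ U, l x ≠ 0
  null : ∀ x ∈ U, g.val x (l x) (l x) = 0
  geodesic : ∀ x ∈ U, covDeriv g l l x = 0

end Manifold

end NullFF

end

/-! A null 2-form with 2-dimensional kernel is pointwise `l♭ ∧ a♭` with `l` null, `a` unit and `l ⟂
a` (`exists_null_wedge`): writing it as `A♭ ∧ C♭`, the condition `F² = 0` says that the Gram
determinant of `A`, `C` vanishes. Formulas depending only on a fixed timelike vector make `l`, `a`
smooth and complete them to a null frame `(s, l, a, n)` with kernel spanned by `s`, `l`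
(`exists_frame`). In any such frame `F = φ l♭ ∧ a♭` with `φ = F(a, n)`. Its dual `*F` has kernel
spanned by `a`, `l`, and `χ = *F(s, n)` satisfies `χ² = φ²`. So `F` and `*F` differ only by the
exchange of `s` and `a`.

Closedness gives `dF(a, l, ·) = 0`. The force-free condition makes `j` orthogonal to `l` and `a`,
which amounts to `d*F(s, l, ·) = 0` (`extDeriv_hodge2`). The invariant formula for `d` turns these
equations (`lieBracket_of_extDeriv`) into `g(l, [l, s]) = 0`, `g(l, [l, a]) = 0` and `g(a, [a, l]) +
g(l, [l, n]) = -l(φ)/φ`, `g(s, [s, l]) + g(l, [l, n]) = -l(χ)/χ`. The right-hand sides agree, hence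
`g(s, [s, l]) = g(a, [a, l])`. For a unit field `u` one has `g(∇_u l, u) = g(u, [u, l])`, so this is
the equipartition, valid in every adapted frame.

For `v` among the frame fields, `g(∇_l l, v) = -g(l, [l, v])`. The components against `s`, `l`, `a`
therefore vanish, so `∇_l l` is a multiple of `l`, zero as soon as `g(l, [l, n]) = 0`. Replacing
`l`, `n` by `e^h l`, `e^{-h} n` achieves this when `l(h) = -g(l, [l, n])`, a transport equation
solved by characteristics (`exists_smooth_transport`). The smooth flow behind it comes from the
implicit function theorem in a space of continuous curves. Involutivity of the kernel is the
invariant formula for `dF = 0` again, and degeneracy holds because `l ⟂ s, l`. -/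

/-! ### Smooth dependence of solutions of an autonomous ODE on time and initial value -/

namespace SmoothFlow

open ContinuousMap Set

/-! ### Superposition operators on spaces of continuous maps -/

section Nemytskii

variable {K : Type} [TopologicalSpace K] [CompactSpace K]
  {V F : Type} [NormedAddCommGroup V] [NormedSpace ℝ V] [NormedAddCommGroup F] [NormedSpace ℝ F]

/-- Pointwise application of a continuous family of linear maps to a continuous map. -/
noncomputable def pointwiseApply : C(K, V →L[ℝ] F) →L[ℝ] C(K, V) →L[ℝ] C(K, F) :=
  LinearMap.mkContinuous₂
    (LinearMap.mk₂ ℝ (fun (A : C(K, V →L[ℝ] F)) (γ : C(K, V)) =>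
        (⟨fun t => A t (γ t), A.continuous.clm_apply γ.continuous⟩ : C(K, F)))
      (fun _ _ _ => by ext; simp) (fun _ _ _ => by ext; simp)
      (fun _ _ _ => by ext; simp) (fun _ _ _ => by ext; simp)) 1
    (fun A γ => by
      rw [one_mul]
      refine (ContinuousMap.norm_le _ (by positivity)).2 fun t => ?_
      exact (A t).le_of_opNorm_le_of_le (A.norm_coe_le_norm t) (γ.norm_coe_le_norm t))

@[simp]
theorem pointwiseApply_apply (A : C(K, V →L[ℝ] F)) (γ : C(K, V)) (t : K) :
    pointwiseApply A γ t = A t (γ t) := rfl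

/-- The range of `γ` is compact, so `fderiv ℝ f` is uniformly continuous along it. One radius `δ`
then serves every `t`, and the mean value inequality on `ball (γ t) δ` bounds the error in the sup
norm. -/
theorem hasFDerivAt_comp_left {f : V → F} (hf : ContDiff ℝ 1 f) (γ : C(K, V)) :
    HasFDerivAt (fun η : C(K, V) => (⟨f, hf.continuous⟩ : C(V, F)).comp η)
      (pointwiseApply ((⟨fderiv ℝ f, hf.continuous_fderiv one_ne_zero⟩ : C(V, V →L[ℝ] F)).comp γ))
      γ := by
  rw [hasFDerivAt_iff_isLittleO, Asymptotics.isLittleO_iff]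
  intro ε hε
  have huc := (isCompact_range γ.continuous).uniformContinuousAt_of_continuousAt (fderiv ℝ f)
    (fun a _ => (hf.continuous_fderiv one_ne_zero).continuousAt) (Metric.dist_mem_uniformity hε)
  obtain ⟨δ, hδ, H⟩ := Metric.mem_uniformity_dist.1 huc
  filter_upwards [Metric.ball_mem_nhds γ hδ] with η hη
  refine (ContinuousMap.norm_le _ (by positivity)).2 fun t => ?_
  have hball : ∀ z ∈ Metric.ball (γ t) δ, ‖fderiv ℝ f z - fderiv ℝ f (γ t)‖ ≤ ε := by
    intro z hz
    have h1 := H (show dist (γ t) z < δ by rwa [dist_comm]) (mem_range_self t)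
    have h2 : dist (fderiv ℝ f (γ t)) (fderiv ℝ f z) < ε := h1
    rw [dist_comm, dist_eq_norm] at h2
    exact h2.le
  have key := (convex_ball (γ t) δ).norm_image_sub_le_of_norm_hasFDerivWithin_le'
    (f := f) (f' := fderiv ℝ f) (φ := fderiv ℝ f (γ t)) (C := ε)
    (fun z _ => ((hf.differentiable one_ne_zero) z).hasFDerivAt.hasFDerivWithinAt) hball
    (Metric.mem_ball_self hδ) ((ContinuousMap.dist_apply_le_dist t).trans_lt hη)
  refine (le_of_eq ?_).trans (key.trans (mul_le_mul_of_nonneg_left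
    ((η - γ).norm_coe_le_norm t) hε.le))
  simp

/-- The derivative is `pointwiseApply` composed with the superposition operator of `fderiv ℝ f`, an
operator of the same kind with another target. Hence the induction on `n` runs over all targets `F`.
-/
theorem contDiff_comp_left_nat (n : ℕ) : ∀ {F : Type} [NormedAddCommGroup F] [NormedSpace ℝ F]
    {f : V → F} (hf : ContDiff ℝ ∞ f),
    ContDiff ℝ n (fun η : C(K, V) => (⟨f, hf.continuous⟩ : C(V, F)).comp η) := by
  induction n with
  | zero =>
    intro F _ _ f hf
    exact contDiff_zero.2 (ContinuousMap.continuous_postcomp _)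
  | succ n ih =>
    intro F _ _ f hf
    have hf' : ContDiff ℝ ∞ (fderiv ℝ f) := hf.fderiv_right le_rfl
    have hpt : ContDiff ℝ n (pointwiseApply (K := K) (V := V) (F := F)) :=
      ContinuousLinearMap.contDiff _
    have h := (contDiff_succ_iff_hasFDerivAt (𝕜 := ℝ) (n := n)
      (f := fun η : C(K, V) => (⟨f, hf.continuous⟩ : C(V, F)).comp η)).2
      ⟨fun γ => pointwiseApply ((⟨fderiv ℝ f, hf'.continuous⟩ : C(V, V →L[ℝ] F)).comp γ),
        hpt.comp (ih hf'),
        fun γ => hasFDerivAt_comp_left (hf.of_le (by exact_mod_cast le_top)) γ⟩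
    exact_mod_cast h

/-- Composition with a smooth map is a smooth operation on continuous maps. -/
theorem contDiff_comp_left {f : V → F} (hf : ContDiff ℝ ∞ f) :
    ContDiff ℝ ∞ (fun η : C(K, V) => (⟨f, hf.continuous⟩ : C(V, F)).comp η) :=
  contDiff_infty.2 fun n => contDiff_comp_left_nat n hf

end Nemytskii

/-! ### Inverse function theorem on a neighbourhood -/

section InverseFunction

variable {E F : Type} [NormedAddCommGroup E] [NormedSpace ℝ E] [CompleteSpace E]
  [NormedAddCommGroup F] [NormedSpace ℝ F]

/-- The inverse function theorem, with smoothness of the inverse on a whole neighbourhood. -/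
theorem exists_smooth_local_inverse {f : E → F} {a : E} {f' : E ≃L[ℝ] F}
    (hf : ∀ᶠ x in 𝓝 a, ContDiffAt ℝ ∞ f x) (hf' : HasFDerivAt f (f' : E →L[ℝ] F) a) :
    ∃ g : F → E, g (f a) = a ∧ (∀ᶠ y in 𝓝 (f a), ContDiffAt ℝ ∞ g y ∧ f (g y) = y) ∧
      ∀ᶠ x in 𝓝 a, g (f x) = x := by
  have hfa : ContDiffAt ℝ ∞ f a := hf.self_of_nhds
  have hstrict : HasStrictFDerivAt f (f' : E →L[ℝ] F) a :=
    hfa.hasStrictFDerivAt' hf' (by simp)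
  let e := hstrict.toOpenPartialHomeomorph f
  have he : ⇑e = f := hstrict.toOpenPartialHomeomorph_coe
  have ha : a ∈ e.source := hstrict.mem_toOpenPartialHomeomorph_source
  have hfa_mem : f a ∈ e.target := by rw [← he]; exact e.map_source ha
  have hsymm : e.symm (f a) = a := by rw [← he]; exact e.left_inv ha
  have hderiv : ContinuousAt (fderiv ℝ f) a :=
    (hfa.fderiv_right (m := 0) (by simp)).continuousAt
  -- Invertible operators form an open set, so the derivative is invertible at all nearby points and
  -- smoothness of the inverse holds at each of them.
  have hinv : ∀ᶠ x in 𝓝 a, ∃ A : E ≃L[ℝ] F, (A : E →L[ℝ] F) = fderiv ℝ f x := by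
    have h := ContinuousLinearEquiv.nhds f'
    rw [← hf'.fderiv] at h
    exact hderiv h
  have hcont : ContinuousAt e.symm (f a) := e.continuousAt_symm hfa_mem
  have hgood : ∀ᶠ y in 𝓝 (f a), ContDiffAt ℝ ∞ f (e.symm y) ∧
      ∃ A : E ≃L[ℝ] F, (A : E →L[ℝ] F) = fderiv ℝ f (e.symm y) := by
    rw [ContinuousAt, hsymm] at hcont
    exact hcont (hf.and hinv)
  refine ⟨e.symm, hsymm, ?_, ?_⟩
  · filter_upwards [hgood, e.open_target.mem_nhds hfa_mem] with y ⟨h1, A, hA⟩ hy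
    refine ⟨e.contDiffAt_symm hy (f₀' := A) ?_ (by rwa [he]), ?_⟩
    · rw [he, hA]
      exact (h1.differentiableAt (by simp)).hasFDerivAt
    · rw [← he]; exact e.right_inv hy
  · filter_upwards [e.open_source.mem_nhds ha] with x hx
    rw [← he]; exact e.left_inv hx

end InverseFunction

/-! ### Smooth flows and the transport equation -/

section Flow

variable {V : Type} [NormedAddCommGroup V] [NormedSpace ℝ V] [CompleteSpace V]

/-- The primitive `t ↦ ∫ₛ₌₀ᵗ γ s` of a curve on the unit interval. -/
noncomputable def primitive : C(unitInterval, V) →L[ℝ] C(unitInterval, V) :=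
  LinearMap.mkContinuous
    { toFun := fun γ => ⟨fun t => ∫ s in (0 : ℝ)..t, γ (projIcc 0 1 zero_le_one s),
        (intervalIntegral.continuous_primitive (fun a b =>
          (γ.continuous.comp continuous_projIcc).intervalIntegrable a b) 0).comp
          continuous_subtype_val⟩
      map_add' := fun γ η => by
        ext t
        exact intervalIntegral.integral_add
          ((γ.continuous.comp continuous_projIcc).intervalIntegrable _ _)
          ((η.continuous.comp continuous_projIcc).intervalIntegrable _ _)
      map_smul' := fun c γ => by
        ext t
        exact intervalIntegral.integral_smul c _ } 1
    (fun γ => by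
      rw [one_mul]
      refine (ContinuousMap.norm_le _ (by positivity)).2 fun t => ?_
      refine (intervalIntegral.norm_integral_le_of_norm_le_const
        (C := ‖γ‖) fun s _ => γ.norm_coe_le_norm _).trans ?_
      rw [sub_zero, abs_of_nonneg t.2.1]
      exact mul_le_of_le_one_right (norm_nonneg _) t.2.2)

omit [CompleteSpace V] in
theorem primitive_apply (γ : C(unitInterval, V)) (t : unitInterval) :
    primitive γ t = ∫ s in (0 : ℝ)..t, γ (projIcc 0 1 zero_le_one s) := rfl

/-- The smooth local flow of a smooth vector field, in integral form. -/
theorem exists_smooth_integral_flow {X : V → V} (hX : ContDiff ℝ ∞ X) (v₀ : V) :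
    ∃ φ : V × ℝ → V, (∀ᶠ p in 𝓝 (v₀, (0 : ℝ)), ContDiffAt ℝ ∞ φ p) ∧
      ∀ᶠ p in 𝓝 (v₀, (0 : ℝ)), φ p = p.1 + ∫ r in (0 : ℝ)..p.2, X (φ (p.1, r)) := by
  let N : C(unitInterval, V) → C(unitInterval, V) := fun η => (⟨X, hX.continuous⟩ : C(V, V)).comp η
  -- Time is rescaled to the unit interval: a zero `((v, t), η)` of `Φ` is a curve with `η(s) = v +
  -- t ∫₀ˢ X(η)`, that is, `η(s) = φ(v, t s)` for the flow `φ`.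
  let Φ : (V × ℝ) × C(unitInterval, V) → C(unitInterval, V) := fun q =>
    q.2 - ContinuousMap.const _ q.1.1 - q.1.2 • primitive (N q.2)
  let cst : V →L[ℝ] C(unitInterval, V) := ContinuousLinearMap.const ℝ unitInterval
  have hcst : ∀ v, cst v = ContinuousMap.const _ v := fun v => rfl
  have hN : ContDiff ℝ ∞ N := contDiff_comp_left hX
  have hΦ : ContDiff ℝ ∞ Φ := by
    have h1 : ContDiff ℝ ∞ fun q : (V × ℝ) × C(unitInterval, V) => cst q.1.1 :=
      cst.contDiff.comp (contDiff_fst.comp contDiff_fst)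
    have h2 : ContDiff ℝ ∞ fun q : (V × ℝ) × C(unitInterval, V) => primitive (N q.2) :=
      primitive.contDiff.comp (hN.comp contDiff_snd)
    exact (contDiff_snd.sub h1).sub ((contDiff_snd.comp contDiff_fst).smul h2)
  let u : (V × ℝ) × C(unitInterval, V) := ((v₀, 0), ContinuousMap.const _ v₀)
  have hΦu : Φ u = 0 := by simp [Φ, u]
  -- At `t = 0` the integral term drops out, so the partial derivative in the curve is the identity.
  have hinr : (fderiv ℝ Φ u ∘L .inr ℝ (V × ℝ) C(unitInterval, V)) = .id ℝ _ := by
    have h1 : HasFDerivAt (fun η : C(unitInterval, V) => Φ ((v₀, 0), η))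
        (fderiv ℝ Φ u ∘L .inr ℝ (V × ℝ) C(unitInterval, V)) u.2 :=
      ((hΦ.differentiable (by simp)) u).hasFDerivAt.comp (u.2) (hasFDerivAt_prodMk_right _ _)
    have h2 : HasFDerivAt (fun η : C(unitInterval, V) => Φ ((v₀, 0), η))
        (.id ℝ _) u.2 := by
      simp only [Φ, zero_smul, sub_zero]
      exact (hasFDerivAt_id _).sub_const _
    exact h1.unique h2
  let A : V × ℝ →L[ℝ] C(unitInterval, V) :=
    fderiv ℝ Φ u ∘L .inl ℝ (V × ℝ) C(unitInterval, V)
  have hA : ∀ q, fderiv ℝ Φ u q = A q.1 + q.2 := by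
    intro q
    have h2 : fderiv ℝ Φ u (0, q.2) = q.2 := congrArg (fun B => B q.2) hinr
    conv_rhs => rw [← h2]
    change _ = fderiv ℝ Φ u (q.1, 0) + _
    rw [← map_add]
    simp
  -- The implicit function is extracted from the local inverse of `(p, η) ↦ (p, Φ (p, η))`.
  let T : (V × ℝ) × C(unitInterval, V) → (V × ℝ) × C(unitInterval, V) := fun q => (q.1, Φ q)
  have hT : ContDiff ℝ ∞ T := contDiff_fst.prodMk hΦ
  let T' : ((V × ℝ) × C(unitInterval, V)) ≃L[ℝ] ((V × ℝ) × C(unitInterval, V)) :=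
    ContinuousLinearEquiv.equivOfInverse
      ((ContinuousLinearMap.fst ℝ _ _).prod (fderiv ℝ Φ u))
      ((ContinuousLinearMap.fst ℝ _ _).prod (.snd ℝ _ _ - A ∘L .fst ℝ _ _))
      (fun q => by ext1 <;> simp [hA]) (fun q => by ext1 <;> simp [hA])
  have hTT' : HasFDerivAt T (T' : _ →L[ℝ] _) u :=
    hasFDerivAt_fst.prodMk ((hΦ.differentiable (by simp)) u).hasFDerivAt
  obtain ⟨g, hg0, hg1, hg2⟩ := exists_smooth_local_inverse
    (Filter.Eventually.of_forall fun x => hT.contDiffAt) hTT'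
  have hTu : T u = ((v₀, 0), 0) := by simp only [T, hΦu]; rfl
  rw [hTu] at hg0 hg1
  let ψ : V × ℝ → C(unitInterval, V) := fun p => (g (p, 0)).2
  have hins : ContinuousAt (fun p : V × ℝ => (p, (0 : C(unitInterval, V)))) (v₀, 0) := by fun_prop
  have hg1' := hins.eventually hg1
  have hψ : ∀ᶠ p in 𝓝 (v₀, (0 : ℝ)), ContDiffAt ℝ ∞ ψ p := by
    filter_upwards [hg1'] with p hp
    exact contDiffAt_snd.comp p (hp.1.comp p (contDiffAt_id.prodMk contDiffAt_const))
  have hψ0 : ψ (v₀, 0) = ContinuousMap.const _ v₀ := by simp only [ψ, hg0]; rfl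
  let ev : C(unitInterval, V) →L[ℝ] V := ContinuousMap.evalCLM ℝ 1
  refine ⟨fun p => ψ p 1, hψ.mono fun p hp => ev.contDiff.contDiffAt.comp _ hp, ?_⟩
  have hsol : ∀ᶠ p in 𝓝 (v₀, (0 : ℝ)), Φ (p, ψ p) = 0 := by
    filter_upwards [hg1'] with p hp
    have h1 : (g (p, 0)).1 = p := congrArg Prod.fst hp.2
    have h2 : Φ (g (p, 0)) = 0 := congrArg Prod.snd hp.2
    rwa [← Prod.mk.eta (p := g (p, 0)), h1] at h2
  -- The left inverse property gives local uniqueness: every solution close to `u` is the one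
  -- provided by `ψ`.
  have huniq : ∀ᶠ q in 𝓝 u, Φ q = 0 → ψ q.1 = q.2 := by
    filter_upwards [hg2] with q hq h
    change (g (q.1, 0)).2 = q.2
    rw [← h, show (q.1, Φ q) = T q from rfl, hq]
  obtain ⟨r, hr, hball⟩ := Metric.eventually_nhds_iff.1 huniq
  have hnear : ∀ᶠ p in 𝓝 (v₀, (0 : ℝ)), dist (ψ p) (ContinuousMap.const _ v₀) < r := by
    have := hψ.self_of_nhds.continuousAt
    rw [ContinuousAt, hψ0] at this
    exact this (Metric.ball_mem_nhds _ hr)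
  filter_upwards [hsol, hnear, Metric.ball_mem_nhds (v₀, (0 : ℝ)) hr] with p h1 h2 h3
  have hint : ∀ t : unitInterval, ψ p t = p.1 + p.2 • ∫ s in (0 : ℝ)..t,
      X (ψ p (projIcc 0 1 zero_le_one s)) := by
    intro t
    have := congrArg (fun η : C(unitInterval, V) => η t) h1
    simp only [Φ, ContinuousMap.sub_apply, ContinuousMap.const_apply, ContinuousMap.smul_apply,
      primitive_apply, ContinuousMap.zero_apply] at this
    rw [sub_sub, sub_eq_zero] at this
    exact this
  -- The curve `s ↦ ψ p (t s)` solves the equation for the time `p.2 * t` and stays within distance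
  -- `r` of `u`, so by uniqueness it is `ψ (p.1, p.2 * t)`. This turns the equation on the unit
  -- interval into the integral equation in the true time.
  have hscale : ∀ t : unitInterval, ψ (p.1, p.2 * t) 1 = ψ p t := by
    intro t
    let η : C(unitInterval, V) := ⟨fun s => ψ p (t * s), by fun_prop⟩
    have hη : Φ ((p.1, p.2 * t), η) = 0 := by
      ext s
      simp only [Φ, ContinuousMap.sub_apply, ContinuousMap.const_apply, ContinuousMap.smul_apply,
        primitive_apply, ContinuousMap.zero_apply]
      rw [sub_sub, sub_eq_zero]
      change ψ p (t * s) = _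
      rw [hint (t * s), mul_smul]
      congr 2
      have h := intervalIntegral.smul_integral_comp_mul_left (a := 0) (b := (s : ℝ))
        (fun x => X (ψ p (projIcc 0 1 zero_le_one x))) (t : ℝ)
      rw [mul_zero] at h
      rw [show ((t * s : unitInterval) : ℝ) = t * s from rfl, ← h]
      congr 1
      refine intervalIntegral.integral_congr fun x hx => ?_
      rw [uIcc_of_le s.2.1] at hx
      have hx1 : x ∈ Icc (0 : ℝ) 1 := ⟨hx.1, hx.2.trans s.2.2⟩
      have hx2 : (t : ℝ) * x ∈ Icc (0 : ℝ) 1 := unitInterval.mul_mem t.2 hx1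
      change X (ψ p (projIcc 0 1 zero_le_one (t * x))) = X (ψ p (t * projIcc 0 1 zero_le_one x))
      rw [projIcc_of_mem _ hx1, projIcc_of_mem _ hx2]
      rfl
    have hdist : dist (((p.1, p.2 * t), η) : (V × ℝ) × C(unitInterval, V)) u < r := by
      rw [Metric.mem_ball, Prod.dist_eq, max_lt_iff] at h3
      refine max_lt (max_lt h3.1 ?_) ?_
      · refine lt_of_le_of_lt ?_ h3.2
        simp only [dist_zero_right, u, norm_mul, Real.norm_eq_abs, abs_of_nonneg t.2.1]
        exact mul_le_of_le_one_right (abs_nonneg _) t.2.2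
      · refine lt_of_le_of_lt ((ContinuousMap.dist_le dist_nonneg).2 fun s => ?_) h2
        exact ContinuousMap.dist_apply_le_dist (f := ψ p) (g := ContinuousMap.const _ v₀) (t * s)
    rw [hball hdist hη]
    simp [η]
  have h := hint 1
  rw [h, Icc.coe_one]
  congr 1
  have hs := intervalIntegral.smul_integral_comp_mul_left (a := 0) (b := 1)
        (fun x => X (ψ (p.1, x) 1)) p.2
  rw [mul_zero, mul_one] at hs
  rw [← hs]
  congr 1
  refine intervalIntegral.integral_congr fun x hx => ?_
  rw [uIcc_of_le zero_le_one] at hx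
  rw [projIcc_of_mem _ hx, ← hscale ⟨x, hx⟩]

/-- The smooth local flow of a smooth vector field. -/
theorem exists_smooth_flow {X : V → V} (hX : ContDiff ℝ ∞ X) (v₀ : V) :
    ∃ φ : V × ℝ → V, (∀ᶠ p in 𝓝 (v₀, (0 : ℝ)), ContDiffAt ℝ ∞ φ p) ∧
      (∀ᶠ v in 𝓝 v₀, φ (v, 0) = v) ∧
      ∀ᶠ p in 𝓝 (v₀, (0 : ℝ)), HasDerivAt (fun t => φ (p.1, t)) (X (φ p)) p.2 := by
  obtain ⟨φ, hφ, hint⟩ := exists_smooth_integral_flow hX v₀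
  refine ⟨φ, hφ, ?_, ?_⟩
  · have hc : ContinuousAt (fun v : V => (v, (0 : ℝ))) v₀ := by fun_prop
    filter_upwards [hc.eventually hint] with v hv
    simpa using hv
  · obtain ⟨r, hr, hball⟩ := Metric.eventually_nhds_iff_ball.1 (hφ.and hint)
    filter_upwards [Metric.ball_mem_nhds (v₀, (0 : ℝ)) hr] with p hp
    -- Balls of `V × ℝ` are products, so the whole time segment from `0` to `p.2` stays where the
    -- integral equation holds.
    rw [← ball_prod_same] at hball hp
    have hcont : ContinuousOn (fun t => X (φ (p.1, t))) (Metric.ball 0 r) := fun t ht =>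
      (hX.continuous.continuousAt.comp (ContinuousAt.comp (f := fun t : ℝ => (p.1, t))
        (hball (p.1, t) ⟨hp.1, ht⟩).1.continuousAt (by fun_prop))).continuousWithinAt
    have hsub : uIcc 0 p.2 ⊆ Metric.ball (0 : ℝ) r := by
      rw [← segment_eq_uIcc]
      exact (convex_ball (0 : ℝ) r).segment_subset (Metric.mem_ball_self hr) hp.2
    have hd : HasDerivAt (fun t => p.1 + ∫ s in (0 : ℝ)..t, X (φ (p.1, s))) (X (φ p)) p.2 := by
      refine HasDerivAt.const_add _ ?_
      have hnhds : Metric.ball (0 : ℝ) r ∈ 𝓝 p.2 := Metric.isOpen_ball.mem_nhds hp.2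
      exact intervalIntegral.integral_hasDerivAt_right
        (hcont.mono hsub).intervalIntegrable
        (hcont.stronglyMeasurableAtFilter Metric.isOpen_ball _ hp.2) (hcont.continuousAt hnhds)
    refine hd.congr_of_eventuallyEq ?_
    filter_upwards [Metric.isOpen_ball.mem_nhds hp.2] with t ht
    exact (hball (p.1, t) ⟨hp.1, ht⟩).2

/-- Near a point where the smooth vector field `X` does not vanish, the equation `X h = c` has a
smooth solution. -/
theorem exists_smooth_transport {X : V → V} {c : V → ℝ} (hX : ContDiff ℝ ∞ X)
    (hc : ContDiff ℝ ∞ c) {y₀ : V} (h0 : X y₀ ≠ 0) :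
    ∃ h : V → ℝ, ∀ᶠ y in 𝓝 y₀, ContDiffAt ℝ ∞ h y ∧ fderiv ℝ h y (X y) = c y := by
  -- Characteristics: along the flow of `(X, c)` the last coordinate accumulates the integral of `c`
  -- over the orbit of `X`.
  let Y : V × ℝ → V × ℝ := fun v => (X v.1, c v.1)
  have hY : ContDiff ℝ ∞ Y := (hX.comp contDiff_fst).prodMk (hc.comp contDiff_fst)
  obtain ⟨φ, hφ, hφ0, hφd⟩ := exists_smooth_flow hY (y₀, 0)
  obtain ⟨lam, hlam⟩ := SeparatingDual.exists_eq_one (R := ℝ) h0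
  let P : V →L[ℝ] V := .id ℝ V - lam.smulRight (X y₀)
  have hPX : P (X y₀) = 0 := by simp [P, hlam]
  -- Start on the hyperplane `y₀ + ker lam`, transverse to `X y₀`, with value `0`, and flow for the
  -- time `lam (z - y₀)`.
  let ι : V → (V × ℝ) × ℝ := fun z => ((y₀ + P (z - y₀), 0), lam (z - y₀))
  let ι' : V →L[ℝ] (V × ℝ) × ℝ := (P.prod 0).prod lam
  have hι : ContDiff ℝ ∞ ι := by fun_prop
  have hι' : ∀ z, HasFDerivAt ι ι' z := by
    intro z
    have h1 : HasFDerivAt (fun z : V => z - y₀) (.id ℝ V) z := (hasFDerivAt_id z).sub_const y₀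
    exact (((P.hasFDerivAt.comp z h1).const_add y₀).prodMk (hasFDerivAt_const _ _)).prodMk
      (lam.hasFDerivAt.comp z h1)
  have hι0 : ι y₀ = ((y₀, 0), 0) := by simp [ι]
  have hιc : Filter.Tendsto ι (𝓝 y₀) (𝓝 ((y₀, 0), 0)) := by
    rw [← hι0]; exact hι.continuous.continuousAt
  have hφ00 : φ ((y₀, 0), 0) = (y₀, 0) := hφ0.self_of_nhds
  let Φ : V → V × ℝ := fun z => φ (ι z)
  have hΦ : ∀ᶠ z in 𝓝 y₀, ContDiffAt ℝ ∞ Φ z := by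
    filter_upwards [hιc.eventually hφ] with z hz
    exact ContDiffAt.comp z hz hι.contDiffAt
  -- the derivative of `Φ` along the constant field `X y₀`
  have hΦX : ∀ᶠ z in 𝓝 y₀, fderiv ℝ Φ z (X y₀) = Y (Φ z) := by
    filter_upwards [hιc.eventually hφd, hΦ] with z hz hz'
    have h1 : HasDerivAt (fun t : ℝ => Φ (z + t • X y₀)) (fderiv ℝ Φ z (X y₀)) 0 := by
      have hline : HasDerivAt (fun t : ℝ => z + t • X y₀) (X y₀) 0 := by
        simpa using ((hasDerivAt_id (0 : ℝ)).smul_const (X y₀)).const_add z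
      have hz0 : HasFDerivAt Φ (fderiv ℝ Φ z) (z + (0 : ℝ) • X y₀) := by
        simpa using (hz'.differentiableAt (by simp)).hasFDerivAt
      exact hz0.comp_hasDerivAt 0 hline
    have h2 : HasDerivAt (fun t : ℝ => Φ (z + t • X y₀)) (Y (Φ z)) 0 := by
      -- Moving `z` along `X y₀` leaves the starting point fixed and only lengthens the time.
      have h3 : ∀ t : ℝ, Φ (z + t • X y₀) = φ ((ι z).1, (ι z).2 + t) := by
        intro t
        have : z + t • X y₀ - y₀ = (z - y₀) + t • X y₀ := by abel
        simp only [Φ, ι, this, map_add, map_smul, hPX, hlam, smul_zero, add_zero, smul_eq_mul,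
          mul_one]
      simp only [h3]
      have h4 : HasDerivAt (fun t => φ ((ι z).1, t)) (Y (Φ z)) ((ι z).2 + 0) := by
        simpa using hz
      exact h4.comp_const_add _ _
    exact h1.unique h2
  let Ψ : V → V := fun z => (Φ z).1
  have hΨ : ∀ᶠ z in 𝓝 y₀, ContDiffAt ℝ ∞ Ψ z :=
    hΦ.mono fun z hz => contDiffAt_fst.comp z hz
  have hΦy : Φ y₀ = (y₀, 0) := by simp only [Φ, hι0, hφ00]
  have hΨy : Ψ y₀ = y₀ := by simp only [Ψ, hΦy]
  -- The derivative is the identity on `ker lam`, where the flow time is `0`, and it maps `X y₀` to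
  -- `X y₀`. Thus `Ψ` straightens `X` near `y₀`.
  have hΨ' : HasFDerivAt Ψ ((ContinuousLinearEquiv.refl ℝ V : V ≃L[ℝ] V) : V →L[ℝ] V) y₀ := by
    have hd := (hΦ.self_of_nhds.differentiableAt (by simp)).hasFDerivAt
    have hdφ : HasFDerivAt φ (fderiv ℝ φ ((y₀, 0), 0)) ((y₀, 0), 0) :=
      (hφ.self_of_nhds.differentiableAt (by simp)).hasFDerivAt
    have hbase : HasFDerivAt (fun v : V × ℝ => φ (v, 0))
        (fderiv ℝ φ ((y₀, 0), 0) ∘L .inl ℝ (V × ℝ) ℝ) (y₀, 0) :=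
      hdφ.comp (y₀, 0) (hasFDerivAt_prodMk_left _ _)
    have hbase' : fderiv ℝ φ ((y₀, 0), 0) ∘L .inl ℝ (V × ℝ) ℝ = .id ℝ _ :=
      hbase.unique ((hasFDerivAt_id _).congr_of_eventuallyEq hφ0)
    have hdι : fderiv ℝ Φ y₀ = fderiv ℝ φ ((y₀, 0), 0) ∘L ι' := by
      have h5 := hι' y₀
      rw [← hι0] at hdφ
      rw [← hι0]
      exact hd.unique (hdφ.comp y₀ h5)
    have hP : ∀ z, fderiv ℝ Φ y₀ (P z) = (P z, 0) := by
      intro z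
      have hlP : lam (P z) = 0 := by simp [P, hlam]
      have hPP : P (P z) = P z := by
        have h5 : ∀ x, P x = x - lam x • X y₀ := fun x => by simp [P]
        rw [h5 (P z), hlP, zero_smul, sub_zero]
      rw [hdι]
      change fderiv ℝ φ ((y₀, 0), 0) ((P (P z), 0), lam (P z)) = _
      rw [hlP, hPP]
      exact congrArg (fun B => B ((P z, 0) : V × ℝ)) hbase'
    have hfst := (hasFDerivAt_fst (𝕜 := ℝ) (p := Φ y₀)).comp y₀ hd
    refine hfst.congr_fderiv ?_
    ext z
    have hz : z = P z + lam z • X y₀ := by simp [P]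
    have h6 : fderiv ℝ Φ y₀ z = (P z, 0) + lam z • Y (Φ y₀) := by
      conv_lhs => rw [hz]
      rw [map_add, hP, map_smul, hΦX.self_of_nhds]
    change (fderiv ℝ Φ y₀ z).1 = z
    rw [h6, hΦy]
    conv_rhs => rw [hz]
    simp [Y]
  obtain ⟨g, hg0, hg1, hg2⟩ := exists_smooth_local_inverse hΨ hΨ'
  rw [hΨy] at hg0 hg1
  have hgc : Filter.Tendsto g (𝓝 y₀) (𝓝 y₀) := by
    have := hg1.self_of_nhds.1.continuousAt
    rwa [ContinuousAt, hg0] at this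
  -- The solution is the accumulated value read at the flow-box preimage. Differentiating `h ∘ Ψ =
  -- Prod.snd ∘ Φ` along `X y₀` gives `X h = c`.
  refine ⟨fun y => (Φ (g y)).2, ?_⟩
  have hh : ∀ᶠ y in 𝓝 y₀, ContDiffAt ℝ ∞ (fun y => (Φ (g y)).2) y := by
    filter_upwards [hg1, hgc.eventually hΦ] with y h1 h2
    exact contDiffAt_snd.comp y (ContDiffAt.comp (g := Φ) y h2 h1.1)
  filter_upwards [hh, hg1, hgc.eventually (hg2.eventually_nhds), hgc.eventually hΦ,
    hgc.eventually hΦX] with y h1 h2 h3 h4 h5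
  refine ⟨h1, ?_⟩
  have hd := (h4.differentiableAt (by simp)).hasFDerivAt
  have hfst := (hasFDerivAt_fst (𝕜 := ℝ) (p := Φ (g y))).comp (g y) hd
  have hsnd := (hasFDerivAt_snd (𝕜 := ℝ) (p := Φ (g y))).comp (g y) hd
  have hΨg : Ψ (g y) = y := h2.2
  have hcomp : HasFDerivAt (fun z => (Φ (g (Ψ z))).2) _ (g y) :=
    HasFDerivAt.comp (g := fun y => (Φ (g y)).2) (f := Ψ) (g y)
      (by rw [hΨg]; exact (h1.differentiableAt (by simp)).hasFDerivAt) hfst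
  have heq : (fun z => (Φ (g (Ψ z))).2) =ᶠ[𝓝 (g y)] (Prod.snd ∘ Φ) :=
    h3.mono fun z hz => by simp only [Function.comp, hz]
  have huniq := (hcomp.congr_of_eventuallyEq heq.symm).unique hsnd
  have h6 := congrArg (fun B : V →L[ℝ] ℝ => B (X y₀)) huniq
  have hΦ1 : (Φ (g y)).1 = y := hΨg
  simpa [h5, Y, hΦ1] using h6

end Flow
end SmoothFlow

noncomputable section

namespace NullFF

/-! ### Pointwise algebra of Lorentzian forms -/

/-- A symmetric bilinear form of signature `(-1, 1, 1, 1)`. -/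
structure IsLorentz (B : E4 →L[ℝ] E4 →L[ℝ] ℝ) : Prop where
  symm : ∀ v w, B v w = B w v
  signature : ∃ b : Module.Basis (Fin 4) ℝ E4,
    ∀ i j, B (b i) (b j) = if i = j then (if i = 0 then -1 else 1) else 0

/-- A frame `(s, l, a, n)` with `s`, `a` unit, `l`, `n` null, `B(l, n) = -1`, and all other
products zero. -/
structure IsNullFrame (B : E4 →L[ℝ] E4 →L[ℝ] ℝ) (s l a n : E4) : Prop where
  ss : B s s = 1
  aa : B a a = 1
  ll : B l l = 0
  nn : B n n = 0
  ln : B l n = -1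
  ls : B l s = 0
  la : B l a = 0
  sa : B s a = 0
  ns : B n s = 0
  na : B n a = 0

theorem map_basisVec_sum (L : E4 →L[ℝ] ℝ) (x : E4) : ∑ i, x i * L (basisVec i) = L x := by
  conv_rhs => rw [← (EuclideanSpace.basisFun (Fin 4) ℝ).sum_repr x]
  simp [map_sum, basisVec]

theorem sum_smul_proj (L : E4 →L[ℝ] ℝ) :
    ∑ i, L (basisVec i) • (EuclideanSpace.proj i : E4 →L[ℝ] ℝ) = L := by
  ext x
  rw [← map_basisVec_sum L x]
  simp [mul_comm]

section Lorentz

variable {B : E4 →L[ℝ] E4 →L[ℝ] ℝ}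

theorem IsLorentz.apply_eq_coords (hB : IsLorentz B) : ∃ b : Module.Basis (Fin 4) ℝ E4,
    (B (b 0) (b 0) = -1) ∧ ∀ v w, B v w = -(b.repr v 0 * b.repr w 0) + b.repr v 1 * b.repr w 1 +
      b.repr v 2 * b.repr w 2 + b.repr v 3 * b.repr w 3 := by
  obtain ⟨b, hb⟩ := hB.signature
  refine ⟨b, by simp [hb], fun v w => ?_⟩
  conv_lhs => rw [← b.sum_repr v, ← b.sum_repr w, Fin.sum_univ_four, Fin.sum_univ_four]
  simp only [map_add, map_smul, add_apply, smul_apply, hb, smul_eq_mul]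
  simp
  ring

theorem IsLorentz.eq_zero (hB : IsLorentz B) {v : E4} (h : ∀ w, B v w = 0) : v = 0 := by
  obtain ⟨b, hb⟩ := hB.signature
  refine b.ext_elem fun i => ?_
  have h1 := h (b i)
  rw [← b.sum_repr v] at h1
  simp only [map_sum, map_smul, sum_apply, smul_apply, hb,
    smul_eq_mul] at h1
  rw [Finset.sum_eq_single i (by intro j _ hj; simp [hj]) (by simp)] at h1
  by_cases hi : i = 0 <;> simp_all

theorem IsLorentz.ext (hB : IsLorentz B) {v v' : E4} (h : ∀ w, B v w = B v' w) : v = v' := by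
  rw [← sub_eq_zero]
  exact hB.eq_zero fun w => by simp [h w]

theorem IsLorentz.isInvertible (hB : IsLorentz B) : B.IsInvertible := by
  have hinj : Function.Injective B := by
    rw [injective_iff_map_eq_zero]
    intro v hv
    exact hB.eq_zero fun w => by simp [hv]
  have hfr : Module.finrank ℝ E4 = Module.finrank ℝ (E4 →L[ℝ] ℝ) := by
    rw [← (LinearMap.toContinuousLinearMap (𝕜 := ℝ) (E := E4) (F' := ℝ)).finrank_eq]
    exact (Subspace.dual_finrank_eq (K := ℝ) (V := E4)).symm
  have hsurj : Function.Surjective B :=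
    (LinearMap.injective_iff_surjective_of_finrank_eq_finrank (f := (B : E4 →ₗ[ℝ] _)) hfr).1 hinj
  exact ⟨ContinuousLinearEquiv.ofBijective B (LinearMap.ker_eq_bot.2 hinj)
    (LinearMap.range_eq_top.2 hsurj), rfl⟩

theorem IsLorentz.apply_sharp (hB : IsLorentz B) (θ : E4 →L[ℝ] ℝ) : B (sharp B θ) = θ :=
  hB.isInvertible.self_apply_inverse θ

theorem IsLorentz.sharp_apply (hB : IsLorentz B) (v : E4) : sharp B (B v) = v :=
  hB.isInvertible.inverse_apply_self v

theorem IsLorentz.apply_raisedVec (hB : IsLorentz B) (v : E4) (i : Fin 4) :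
    B v (raisedVec B i) = v i := by
  rw [hB.symm, raisedVec, hB.apply_sharp]
  rfl

theorem IsLorentz.sum_smul_raisedVec (hB : IsLorentz B) (v : E4) :
    ∑ i, B v (basisVec i) • raisedVec B i = v := by
  have h : ∑ i, B v (basisVec i) • raisedVec B i = sharp B (B v) := by
    conv_rhs => rw [← sum_smul_proj (B v)]
    simp [sharp, raisedVec, map_sum]
  rw [h, hB.sharp_apply]

theorem sum_smul_basisVec (v : E4) : ∑ i, v i • basisVec i = v := by
  simpa [basisVec] using (EuclideanSpace.basisFun (Fin 4) ℝ).sum_repr v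

/-- With `t`, `v` the spatial parts, Cauchy–Schwarz gives `t0² v0² = (t · v)² ≤ |t|² |v|² ≤ |t|²
v0²`, while `|t|² < t0²`. Hence `v0 = 0`, and then `v = 0`. -/
theorem minkowski_eq_zero_of_orthogonal_timelike {t0 t1 t2 t3 v0 v1 v2 v3 : ℝ}
    (hT : -(t0 * t0) + t1 * t1 + t2 * t2 + t3 * t3 < 0)
    (hv : -(t0 * v0) + t1 * v1 + t2 * v2 + t3 * v3 = 0)
    (hle : -(v0 * v0) + v1 * v1 + v2 * v2 + v3 * v3 ≤ 0) :
    v0 = 0 ∧ v1 = 0 ∧ v2 = 0 ∧ v3 = 0 := by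
  have hcs : (t0 * v0) ^ 2 ≤ (t1 ^ 2 + t2 ^ 2 + t3 ^ 2) * (v1 ^ 2 + v2 ^ 2 + v3 ^ 2) := by
    have : t0 * v0 = t1 * v1 + t2 * v2 + t3 * v3 := by linarith
    rw [this]
    nlinarith [sq_nonneg (t1 * v2 - t2 * v1), sq_nonneg (t1 * v3 - t3 * v1),
      sq_nonneg (t2 * v3 - t3 * v2)]
  have h1 : (t1 ^ 2 + t2 ^ 2 + t3 ^ 2) * (v1 ^ 2 + v2 ^ 2 + v3 ^ 2) ≤
      (t1 ^ 2 + t2 ^ 2 + t3 ^ 2) * v0 ^ 2 :=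
    mul_le_mul_of_nonneg_left (by linarith) (by positivity)
  have h2 : v0 ^ 2 * (t0 ^ 2 - (t1 ^ 2 + t2 ^ 2 + t3 ^ 2)) ≤ 0 := by linarith
  have h3 : 0 < t0 ^ 2 - (t1 ^ 2 + t2 ^ 2 + t3 ^ 2) := by linarith
  have h4 : v0 ^ 2 ≤ 0 := by
    by_contra! h
    exact absurd (mul_pos h h3) (not_lt.2 h2)
  have hsq : ∀ {x : ℝ}, x ^ 2 ≤ 0 → x = 0 := fun h =>
    pow_eq_zero_iff two_ne_zero |>.1 (le_antisymm h (sq_nonneg _))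
  have s1 := sq_nonneg v1
  have s2 := sq_nonneg v2
  have s3 := sq_nonneg v3
  exact ⟨hsq h4, hsq (by linarith), hsq (by linarith), hsq (by linarith)⟩

theorem IsLorentz.pos_of_orthogonal_timelike (hB : IsLorentz B) {T v : E4} (hT : B T T < 0)
    (hv : B T v = 0) (h0 : v ≠ 0) : 0 < B v v := by
  obtain ⟨b, -, hb⟩ := hB.apply_eq_coords
  rw [hb] at hT hv
  rw [hb]
  by_contra! hle
  obtain ⟨e0, e1, e2, e3⟩ := minkowski_eq_zero_of_orthogonal_timelike hT hv hle
  refine h0 (b.ext_elem fun i => ?_)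
  rw [map_zero, Finsupp.zero_apply]
  fin_cases i
  exacts [e0, e1, e2, e3]

theorem IsLorentz.exists_timelike (hB : IsLorentz B) : ∃ T, B T T < 0 := by
  obtain ⟨b, hb, -⟩ := hB.apply_eq_coords
  exact ⟨b 0, by rw [hb]; norm_num⟩

theorem IsLorentz.null_apply_timelike_ne_zero (hB : IsLorentz B) {T l : E4} (hT : B T T < 0)
    (hl : l ≠ 0) (hll : B l l = 0) : B l T ≠ 0 := fun h =>
  (hB.pos_of_orthogonal_timelike hT (by rwa [hB.symm]) hl).ne' hll

/-- Subtracting a multiple of `l` makes `v` orthogonal to a timelike vector and leaves `B v v`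
unchanged, as `l` is null and orthogonal to `v`. -/
theorem IsLorentz.pos_of_orthogonal_null (hB : IsLorentz B) {l v : E4} (hl : l ≠ 0)
    (hll : B l l = 0) (hv : B l v = 0) (hind : ∀ c : ℝ, v ≠ c • l) : 0 < B v v := by
  obtain ⟨T, hT⟩ := hB.exists_timelike
  have hlT := hB.null_apply_timelike_ne_zero hT hl hll
  have h := hB.pos_of_orthogonal_timelike (v := v - (B v T / B l T) • l) hT
    (by rw [hB.symm]; simp; field_simp; ring) (sub_ne_zero.2 (hind _))
  have hv' : B v l = 0 := by rwa [hB.symm]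
  simpa [hll, hv, hv'] using h

/-! #### Null frames -/

theorem IsNullFrame.linearIndependent (hB : IsLorentz B) {s l a n : E4} (h : IsNullFrame B s l a n) :
    LinearIndependent ℝ ![s, l, a, n] := by
  rw [Fintype.linearIndependent_iff]
  intro c hc
  simp only [Fin.sum_univ_four, Matrix.cons_val_zero, Matrix.cons_val_one, Matrix.cons_val] at hc
  have key : ∀ w, c 0 * B w s + c 1 * B w l + c 2 * B w a + c 3 * B w n = 0 := by
    intro w
    simpa using congrArg (B w) hc
  have k0 := key s
  have k1 := key l
  have k2 := key a
  have k3 := key n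
  simp only [h.ss, h.aa, h.ll, h.nn, h.ln, h.ls, h.la, h.sa, h.ns, h.na, hB.symm s l, hB.symm s n,
    hB.symm a s, hB.symm a l, hB.symm a n, hB.symm n l] at k0 k1 k2 k3
  intro i
  fin_cases i <;> simp <;> linarith

/-- The `B`-dual frame of `(s, l, a, n)` is `(s, -n, a, -l)`. -/
theorem IsNullFrame.expand (hB : IsLorentz B) {s l a n : E4} (h : IsNullFrame B s l a n) (x : E4) :
    x = B s x • s - B n x • l + B a x • a - B l x • n := by
  let b := basisOfLinearIndependentOfCardEqFinrank (h.linearIndependent hB) (by simp)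
  have hb : ⇑b = ![s, l, a, n] := coe_basisOfLinearIndependentOfCardEqFinrank _ _
  refine hB.ext fun w => ?_
  rw [hB.symm x, hB.symm _ w]
  have hx : x ∈ Submodule.span ℝ (Set.range b) := by rw [b.span_eq]; trivial
  suffices H : B.flip x = B.flip (B s x • s - B n x • l + B a x • a - B l x • n) from
    congrArg (fun L => L w) H
  refine ContinuousLinearMap.coe_injective (b.ext fun i => ?_)
  rw [hb]
  fin_cases i <;>
  simp [h.ss, h.aa, h.ll, h.nn, h.ln, h.ls, h.la, h.sa, h.ns, h.na, hB.symm s l, hB.symm s n,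
    hB.symm a s, hB.symm a l, hB.symm a n, hB.symm n l]

theorem IsNullFrame.eq_zero (hB : IsLorentz B) {s l a n : E4} (h : IsNullFrame B s l a n) {x : E4}
    (hs : B s x = 0) (hl : B l x = 0) (ha : B a x = 0) (hn : B n x = 0) : x = 0 := by
  rw [h.expand hB x, hs, hl, ha, hn]
  simp

end Lorentz

/-! #### Alternating forms as bilinear maps -/

/-- A `2`-form as a bilinear map. -/
def toBilin (w : E4 [⋀^Fin 2]→L[ℝ] ℝ) : E4 →L[ℝ] E4 →L[ℝ] ℝ :=
  ContinuousLinearMap.compL ℝ E4 (E4 [⋀^Fin 1]→L[ℝ] ℝ) (E4 →L[ℝ] ℝ)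
    ((ContinuousAlternatingMap.ofSubsingletonLIE (𝕜 := ℝ) (E := E4) (F := ℝ)
      (0 : Fin 1)).symm.toContinuousLinearEquiv : _ →L[ℝ] _) w.curryLeft

theorem toBilin_apply (w : E4 [⋀^Fin 2]→L[ℝ] ℝ) (x y : E4) : toBilin w x y = w ![x, y] := by
  change w (Matrix.vecCons x fun _ => y) = _
  congr 1
  ext i
  fin_cases i <;> rfl

theorem contDiff_toBilin {k : ℕ∞ω} : ContDiff ℝ k toBilin := by
  have h : IsBoundedLinearMap ℝ toBilin := by
    refine IsLinearMap.with_bound ⟨fun v w => ?_, fun c w => ?_⟩ 1 fun w => ?_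
    · ext x y
      simp [toBilin_apply]
    · ext x y
      simp [toBilin_apply]
    · refine ContinuousLinearMap.opNorm_le_bound₂ _ (by positivity) fun x y => ?_
      rw [toBilin_apply, one_mul]
      simpa [Fin.prod_univ_two, mul_assoc] using w.le_opNorm ![x, y]
  exact h.contDiff

theorem toBilin_swap (w : E4 [⋀^Fin 2]→L[ℝ] ℝ) (x y : E4) : toBilin w x y = -toBilin w y x := by
  rw [toBilin_apply, toBilin_apply]
  have := w.map_swap ![y, x] (i := 0) (j := 1) (by decide)
  change w _ = -w _ at this
  rw [← this]
  congr 1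
  ext i
  fin_cases i <;> rfl

theorem toBilin_self (w : E4 [⋀^Fin 2]→L[ℝ] ℝ) (x : E4) : toBilin w x x = 0 := by
  linarith [toBilin_swap w x x]

end NullFF
end

noncomputable section

namespace NullFF

/-! ### The volume form and the Hodge star in a null frame -/

section Hodge

variable {B : E4 →L[ℝ] E4 →L[ℝ] ℝ}

/-- The matrix of `B` in the coordinate basis. -/
def gramMatrix (B : E4 →L[ℝ] E4 →L[ℝ] ℝ) : Matrix (Fin 4) (Fin 4) ℝ :=
  Matrix.of fun i j : Fin 4 => B (basisVec i) (basisVec j)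

/-- With the vectors as columns the matrix is `Xᵀ * gramMatrix B * Y`, and `coordDet` is the
determinant of the column matrix. -/
theorem det_apply_apply (B : E4 →L[ℝ] E4 →L[ℝ] ℝ) (X Y : Fin 4 → E4) :
    (Matrix.of fun i j => B (X i) (Y j)).det = (gramMatrix B).det * (coordDet X * coordDet Y) := by
  have h : (Matrix.of fun i j => B (X i) (Y j)) =
      (Matrix.of fun i j => X j i).transpose * gramMatrix B * (Matrix.of fun i j => Y j i) := by
    ext i j
    simp only [Matrix.of_apply, Matrix.mul_apply, Matrix.transpose_apply, gramMatrix]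
    rw [← map_basisVec_sum (B (X i)) (Y j)]
    refine Finset.sum_congr rfl fun k _ => ?_
    rw [mul_comm]
    congr 1
    rw [← ContinuousLinearMap.flip_apply, ← map_basisVec_sum (B.flip (basisVec k)) (X i)]
    rfl
  have hc : ∀ Z : Fin 4 → E4, coordDet Z = (Matrix.of fun i j => Z j i).det := fun Z => rfl
  rw [h, Matrix.det_mul, Matrix.det_mul, Matrix.det_transpose, hc, hc]
  ring

theorem IsNullFrame.det_gram (hB : IsLorentz B) {s l a n : E4} (h : IsNullFrame B s l a n) :
    (Matrix.of fun i j => B (![s, l, a, n] i) (![s, l, a, n] j)).det = -1 := by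
  have hs := hB.symm
  simp [Matrix.det_succ_row_zero, Fin.sum_univ_succ, h.ss, h.aa, h.ll, h.nn, h.ln, h.ls,
    h.la, h.sa, h.ns, h.na, hs a s, hs a l, hs a n, hs n l, Fin.succAbove]

theorem volForm_apply (B : E4 →L[ℝ] E4 →L[ℝ] ℝ) (X : Fin 4 → E4) :
    volForm B X = √|(gramMatrix B).det| * coordDet X := rfl

/-- Only the square is determined: the orientation of the frame is free, and the later arguments are
insensitive to this sign. -/
theorem IsNullFrame.volForm_sq (hB : IsLorentz B) {s l a n : E4} (h : IsNullFrame B s l a n) :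
    volForm B ![s, l, a, n] ^ 2 = 1 := by
  have h1 := h.det_gram hB
  rw [det_apply_apply] at h1
  rw [volForm_apply, mul_pow, Real.sq_sqrt (abs_nonneg _)]
  have hneg : (gramMatrix B).det < 0 := by
    by_contra! hc
    nlinarith [mul_nonneg hc (mul_self_nonneg (coordDet ![s, l, a, n]))]
  rw [abs_of_neg hneg]
  linarith

theorem IsNullFrame.volForm_eq (hB : IsLorentz B) {s l a n : E4} (h : IsNullFrame B s l a n)
    (X : Fin 4 → E4) : volForm B X = -volForm B ![s, l, a, n] *
      (Matrix.of fun i j => B (X i) (![s, l, a, n] j)).det := by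
  have h1 := h.det_gram hB
  rw [det_apply_apply] at h1 ⊢
  rw [volForm_apply, volForm_apply]
  linear_combination (√|(gramMatrix B).det| * coordDet X) * h1

/-- The `3 × 3` determinant of three covectors on three vectors. -/
def det3 (p q r : E4 →L[ℝ] ℝ) (x y z : E4) : ℝ :=
  p x * (q y * r z - q z * r y) - q x * (p y * r z - p z * r y) + r x * (p y * q z - p z * q y)

/-- In `volForm_eq` the row of `l` has the single nonzero entry `B l n = -1`, so the determinant
reduces to the minor of `s`, `l`, `a`. -/
theorem IsNullFrame.volForm_snd (hB : IsLorentz B) {s l a n : E4} (h : IsNullFrame B s l a n)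
    (x y z : E4) : volForm B ![x, y, z, l] =
      volForm B ![s, l, a, n] * det3 (B s) (B l) (B a) x y z := by
  have hs := hB.symm
  rw [h.volForm_eq hB]
  simp [Matrix.det_succ_row_zero, Fin.sum_univ_succ, h.ll, h.ln, h.ls,
    h.la, hs x, hs y, hs z, Fin.succAbove, det3]
  ring

/-- The row of `a` has the single nonzero entry `B a a = 1`, which leaves the minor of `s`, `l`,
`n`. -/
theorem IsNullFrame.volForm_trd (hB : IsLorentz B) {s l a n : E4} (h : IsNullFrame B s l a n)
    (x y z : E4) : volForm B ![x, y, z, a] =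
      volForm B ![s, l, a, n] * det3 (B s) (B l) (B n) x y z := by
  have hs := hB.symm
  rw [h.volForm_eq hB]
  simp [Matrix.det_succ_row_zero, Fin.sum_univ_succ, h.aa, hs a l, hs a s, hs a n, h.sa, h.na,
    h.la, hs x, hs y, hs z, Fin.succAbove, det3]
  ring

/-- Contracting the indices of a `3`-form with three covectors. -/
theorem IsLorentz.sum_raisedVec_three (hB : IsLorentz B) (η : E4 [⋀^Fin 3]→L[ℝ] ℝ) (P Q R : E4) :
    ∑ i, ∑ j, ∑ k, η ![raisedVec B i, raisedVec B j, raisedVec B k] *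
      (B P (basisVec i) * B Q (basisVec j) * B R (basisVec k)) = η ![P, Q, R] := by
  have h1 : ∀ x y, ∑ k, η ![x, y, raisedVec B k] * B R (basisVec k) = η ![x, y, R] := by
    intro x y
    let L : E4 →ₗ[ℝ] ℝ := η.toMultilinearMap.toLinearMap ![x, y, 0] 2
    have hL : ∀ z, L z = η ![x, y, z] := by
      intro z
      change η (Function.update ![x, y, 0] 2 z) = _
      congr 1
      ext i
      fin_cases i <;> rfl
    conv_rhs => rw [← hL, ← hB.sum_smul_raisedVec R]
    simp only [map_sum, map_smul]
    simp only [hL, smul_eq_mul, mul_comm]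
  have h2 : ∀ x z, ∑ j, η ![x, raisedVec B j, z] * B Q (basisVec j) = η ![x, Q, z] := by
    intro x z
    let L : E4 →ₗ[ℝ] ℝ := η.toMultilinearMap.toLinearMap ![x, 0, z] 1
    have hL : ∀ y, L y = η ![x, y, z] := by
      intro y
      change η (Function.update ![x, 0, z] 1 y) = _
      congr 1
      ext i
      fin_cases i <;> rfl
    conv_rhs => rw [← hL, ← hB.sum_smul_raisedVec Q]
    simp only [map_sum, map_smul]
    simp only [hL, smul_eq_mul, mul_comm]
  have h3 : ∀ y z, ∑ i, η ![raisedVec B i, y, z] * B P (basisVec i) = η ![P, y, z] := by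
    intro y z
    let L : E4 →ₗ[ℝ] ℝ := η.toMultilinearMap.toLinearMap ![0, y, z] 0
    have hL : ∀ x, L x = η ![x, y, z] := by
      intro x
      change η (Function.update ![0, y, z] 0 x) = _
      congr 1
      ext i
      fin_cases i <;> rfl
    conv_rhs => rw [← hL, ← hB.sum_smul_raisedVec P]
    simp only [map_sum, map_smul]
    simp only [hL, smul_eq_mul, mul_comm]
  rw [← h3]
  refine Finset.sum_congr rfl fun i _ => ?_
  rw [← h2, Finset.sum_mul]
  refine Finset.sum_congr rfl fun j _ => ?_
  rw [← h1, Finset.sum_mul, Finset.sum_mul]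
  refine Finset.sum_congr rfl fun k _ => ?_
  ring

theorem alternating_three_swap (η : E4 [⋀^Fin 3]→L[ℝ] ℝ) (x y z : E4) :
    η ![y, x, z] = -η ![x, y, z] ∧ η ![x, z, y] = -η ![x, y, z] := by
  constructor
  · have := η.map_swap ![x, y, z] (i := 0) (j := 1) (by decide)
    change η _ = -η _ at this
    rw [← this]
    congr 1
    ext i
    fin_cases i <;> rfl
  · have := η.map_swap ![x, y, z] (i := 1) (j := 2) (by decide)
    change η _ = -η _ at this
    rw [← this]
    congr 1
    ext i
    fin_cases i <;> rfl

/-- The determinant is a signed sum over six permutations, and by alternation each contributes `η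
![P, Q, R]`. The factor `6` cancels the `1/3!` of `hodge3`. -/
theorem IsLorentz.sum_raisedVec_det3 (hB : IsLorentz B) (η : E4 [⋀^Fin 3]→L[ℝ] ℝ) (P Q R : E4) :
    ∑ i, ∑ j, ∑ k, η ![raisedVec B i, raisedVec B j, raisedVec B k] *
      det3 (B P) (B Q) (B R) (basisVec i) (basisVec j) (basisVec k) = 6 * η ![P, Q, R] := by
  have e1 := (alternating_three_swap η P Q R).1
  have e2 := (alternating_three_swap η P Q R).2
  have e3 := (alternating_three_swap η Q P R).2
  have e4 := (alternating_three_swap η P R Q).1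
  have e5 := (alternating_three_swap η Q R P).1
  have h : ∀ i j k, η ![raisedVec B i, raisedVec B j, raisedVec B k] *
      det3 (B P) (B Q) (B R) (basisVec i) (basisVec j) (basisVec k) =
      η ![raisedVec B i, raisedVec B j, raisedVec B k] *
        (B P (basisVec i) * B Q (basisVec j) * B R (basisVec k)) -
      η ![raisedVec B i, raisedVec B j, raisedVec B k] *
        (B P (basisVec i) * B R (basisVec j) * B Q (basisVec k)) -
      η ![raisedVec B i, raisedVec B j, raisedVec B k] *
        (B Q (basisVec i) * B P (basisVec j) * B R (basisVec k)) +
      η ![raisedVec B i, raisedVec B j, raisedVec B k] *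
        (B Q (basisVec i) * B R (basisVec j) * B P (basisVec k)) +
      η ![raisedVec B i, raisedVec B j, raisedVec B k] *
        (B R (basisVec i) * B P (basisVec j) * B Q (basisVec k)) -
      η ![raisedVec B i, raisedVec B j, raisedVec B k] *
        (B R (basisVec i) * B Q (basisVec j) * B P (basisVec k)) := by
    intro i j k
    simp only [det3]
    ring
  simp only [h, Finset.sum_add_distrib, Finset.sum_sub_distrib, hB.sum_raisedVec_three]
  linarith

theorem hodge3_apply (B : E4 →L[ℝ] E4 →L[ℝ] ℝ) (η : E4 [⋀^Fin 3]→L[ℝ] ℝ) (X : E4) :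
    hodge3 B η (fun _ => X) = (1 / 6) * ∑ i, ∑ j, ∑ k,
      η ![raisedVec B i, raisedVec B j, raisedVec B k] *
        volForm B ![basisVec i, basisVec j, basisVec k, X] := by
  have h : ∀ x y z : E4, Matrix.vecCons x (Matrix.vecCons y (Matrix.vecCons z fun _ : Fin 1 => X)) =
      ![x, y, z, X] := by
    intro x y z
    ext i
    fin_cases i <;> rfl
  simp [hodge3, ContinuousAlternatingMap.sum_apply, h]

/-- For `η = d * F`, this and `hodge3_trd` express the components of the current against `l` and
`a`, the ones killed by the force-free condition. -/
theorem IsNullFrame.hodge3_snd (hB : IsLorentz B) {s l a n : E4} (h : IsNullFrame B s l a n)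
    (η : E4 [⋀^Fin 3]→L[ℝ] ℝ) :
    hodge3 B η (fun _ => l) = volForm B ![s, l, a, n] * η ![s, l, a] := by
  have h1 := hB.sum_raisedVec_det3 η s l a
  simp only [hodge3_apply, h.volForm_snd hB, mul_left_comm _ (volForm B _), ← Finset.mul_sum, h1]
  ring

theorem IsNullFrame.hodge3_trd (hB : IsLorentz B) {s l a n : E4} (h : IsNullFrame B s l a n)
    (η : E4 [⋀^Fin 3]→L[ℝ] ℝ) :
    hodge3 B η (fun _ => a) = volForm B ![s, l, a, n] * η ![s, l, n] := by
  have h1 := hB.sum_raisedVec_det3 η s l n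
  simp only [hodge3_apply, h.volForm_trd hB, mul_left_comm _ (volForm B _), ← Finset.mul_sum, h1]
  ring

theorem sum_basisVec_two (ν : E4 [⋀^Fin 4]→L[ℝ] ℝ) (P Q x y : E4) :
    ∑ i, ∑ j, P i * Q j * ν ![basisVec i, basisVec j, x, y] = ν ![P, Q, x, y] := by
  have h1 : ∀ u, ∑ j, Q j * ν ![u, basisVec j, x, y] = ν ![u, Q, x, y] := by
    intro u
    let L : E4 →ₗ[ℝ] ℝ := ν.toMultilinearMap.toLinearMap ![u, 0, x, y] 1
    have hL : ∀ z, L z = ν ![u, z, x, y] := by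
      intro z
      change ν (Function.update ![u, 0, x, y] 1 z) = _
      congr 1
      ext i
      fin_cases i <;> rfl
    conv_rhs => rw [← hL, ← sum_smul_basisVec Q]
    simp only [map_sum, map_smul]
    simp only [hL, smul_eq_mul]
  have h2 : ∑ i, P i * ν ![basisVec i, Q, x, y] = ν ![P, Q, x, y] := by
    let L : E4 →ₗ[ℝ] ℝ := ν.toMultilinearMap.toLinearMap ![0, Q, x, y] 0
    have hL : ∀ z, L z = ν ![z, Q, x, y] := by
      intro z
      change ν (Function.update ![0, Q, x, y] 0 z) = _
      congr 1
      ext i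
      fin_cases i <;> rfl
    conv_rhs => rw [← hL, ← sum_smul_basisVec P]
    simp only [map_sum, map_smul]
    simp only [hL, smul_eq_mul]
  rw [← h2]
  refine Finset.sum_congr rfl fun i _ => ?_
  rw [← h1, Finset.mul_sum]
  exact Finset.sum_congr rfl fun j _ => by ring

/-- The Hodge star of a multiple of `l♭ ∧ a♭`. -/
theorem IsLorentz.hodge2_apply (hB : IsLorentz B) {w : E4 [⋀^Fin 2]→L[ℝ] ℝ} {l a : E4} {ψ : ℝ}
    (hw : ∀ x y, w ![x, y] = ψ * (B l x * B a y - B l y * B a x)) (x y : E4) :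
    hodge2 B w ![x, y] = ψ * volForm B ![l, a, x, y] := by
  have h := sum_basisVec_two (volForm B) l a x y
  have h' := sum_basisVec_two (volForm B) a l x y
  have hsw : volForm B ![a, l, x, y] = -volForm B ![l, a, x, y] := by
    have := (volForm B).map_swap ![l, a, x, y] (i := 0) (j := 1) (by decide)
    change volForm B _ = -volForm B _ at this
    rw [← this]
    congr 1
    ext i
    fin_cases i <;> rfl
  have h0 : hodge2 B w ![x, y] = (1 / 2) * ∑ i, ∑ j,
      (ψ * (l i * a j * volForm B ![basisVec i, basisVec j, x, y]) -
        ψ * (a i * l j * volForm B ![basisVec i, basisVec j, x, y])) := by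
    simp only [hodge2, ContinuousAlternatingMap.smul_apply, ContinuousAlternatingMap.sum_apply, hw,
      hB.apply_raisedVec, smul_eq_mul, ContinuousAlternatingMap.curryLeft_apply_apply]
    congr 1
    refine Finset.sum_congr rfl fun i _ => Finset.sum_congr rfl fun j _ => ?_
    ring
  rw [h0]
  simp only [Finset.sum_sub_distrib, ← Finset.mul_sum, h, h', hsw]
  ring

end Hodge

end NullFF
end

noncomputable section

namespace NullFF

open VectorField

/-! ### Calculus in coordinates -/

section Calculus

variable {G : E4 → E4 →L[ℝ] E4 →L[ℝ] ℝ} {y : E4}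

/-- The Levi-Civita derivative in coordinates. -/
def coordCovDeriv (G : E4 → E4 →L[ℝ] E4 →L[ℝ] ℝ) (X Y : E4 → E4) (y : E4) : E4 :=
  fderiv ℝ Y y (X y) + christoffel G y (X y) (Y y)

theorem apply_christoffel (hB : IsLorentz (G y)) (u v z : E4) :
    G y (christoffel G y u v) z =
      (1 / 2) * (fderiv ℝ G y u v z + fderiv ℝ G y v u z - fderiv ℝ G y z u v) := by
  rw [christoffel, hB.apply_sharp]
  rfl

theorem hasFDerivAt_bilin_apply {X Y : E4 → E4} (hG : DifferentiableAt ℝ G y)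
    (hX : DifferentiableAt ℝ X y) (hY : DifferentiableAt ℝ Y y) (u : E4) :
    fderiv ℝ (fun z => G z (X z) (Y z)) y u =
      fderiv ℝ G y u (X y) (Y y) + G y (fderiv ℝ X y u) (Y y) + G y (X y) (fderiv ℝ Y y u) := by
  have h := ((hG.hasFDerivAt.clm_apply hX.hasFDerivAt).clm_apply hY.hasFDerivAt).fderiv
  rw [h]
  simp
  ring

theorem fderiv_bilin_symm (hG : DifferentiableAt ℝ G y) (hL : ∀ᶠ z in 𝓝 y, IsLorentz (G z))
    (u v w : E4) : fderiv ℝ G y u v w = fderiv ℝ G y u w v := by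
  have h1 := hasFDerivAt_bilin_apply (X := fun _ => v) (Y := fun _ => w) hG
    (differentiableAt_const _) (differentiableAt_const _) u
  have h2 := hasFDerivAt_bilin_apply (X := fun _ => w) (Y := fun _ => v) hG
    (differentiableAt_const _) (differentiableAt_const _) u
  have h3 : (fun z => G z v w) =ᶠ[𝓝 y] fun z => G z w v := hL.mono fun z hz => hz.symm v w
  rw [h3.fderiv_eq] at h1
  simp only [fderiv_fun_const, Pi.zero_apply, zero_apply, map_zero, add_zero] at h1 h2
  rw [← h1, h2]

/-- Compatibility of the connection with the metric. -/
theorem coordCovDeriv_metric {X Y : E4 → E4} (hG : DifferentiableAt ℝ G y)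
    (hL : ∀ᶠ z in 𝓝 y, IsLorentz (G z)) (hX : DifferentiableAt ℝ X y)
    (hY : DifferentiableAt ℝ Y y) (Z : E4 → E4) :
    fderiv ℝ (fun z => G z (X z) (Y z)) y (Z y) =
      G y (coordCovDeriv G Z X y) (Y y) + G y (X y) (coordCovDeriv G Z Y y) := by
  have hB := hL.self_of_nhds
  have hs := fderiv_bilin_symm hG hL
  rw [hasFDerivAt_bilin_apply hG hX hY, coordCovDeriv, coordCovDeriv, map_add, map_add, add_apply,
    apply_christoffel hB, hB.symm (X y) (christoffel _ _ _ _), apply_christoffel hB]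
  linear_combination (1 / 2) * hs (Z y) (X y) (Y y)

/-- Applied to the constant inner products of a frame, this supplies the relations among its
connection coefficients. -/
theorem coordCovDeriv_metric_of_const {X Y : E4 → E4} {c : ℝ} (hG : DifferentiableAt ℝ G y)
    (hL : ∀ᶠ z in 𝓝 y, IsLorentz (G z)) (hX : DifferentiableAt ℝ X y)
    (hY : DifferentiableAt ℝ Y y) (h : ∀ᶠ z in 𝓝 y, G z (X z) (Y z) = c) (Z : E4 → E4) :
    G y (coordCovDeriv G Z X y) (Y y) + G y (X y) (coordCovDeriv G Z Y y) = 0 := by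
  rw [← coordCovDeriv_metric hG hL hX hY]
  have : (fun z => G z (X z) (Y z)) =ᶠ[𝓝 y] fun _ => c := h
  rw [this.fderiv_eq]
  simp

/-- The connection is torsion free. -/
theorem coordCovDeriv_torsion (hG : DifferentiableAt ℝ G y)
    (hL : ∀ᶠ z in 𝓝 y, IsLorentz (G z)) (X Y : E4 → E4) :
    lieBracket ℝ X Y y = coordCovDeriv G X Y y - coordCovDeriv G Y X y := by
  have hc : christoffel G y (X y) (Y y) = christoffel G y (Y y) (X y) := by
    refine hL.self_of_nhds.ext fun z => ?_
    rw [apply_christoffel hL.self_of_nhds, apply_christoffel hL.self_of_nhds,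
      fderiv_bilin_symm hG hL z]
    ring
  rw [coordCovDeriv, coordCovDeriv, lieBracket, hc]
  abel

/-! #### Exterior derivative of a `2`-form on vector fields -/

/-- The invariant formula for `d` in degree two, unfolded from `extDeriv_apply_vectorField`. All use
of `dF` and `d * F` passes through it. -/
theorem extDeriv_two_apply {W : E4 → E4 [⋀^Fin 2]→L[ℝ] ℝ} {X Y Z : E4 → E4}
    (hW : DifferentiableAt ℝ W y) (hX : DifferentiableAt ℝ X y) (hY : DifferentiableAt ℝ Y y)
    (hZ : DifferentiableAt ℝ Z y) :
    extDeriv W y ![X y, Y y, Z y] =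
      fderiv ℝ (fun z => toBilin (W z) (Y z) (Z z)) y (X y) -
      fderiv ℝ (fun z => toBilin (W z) (X z) (Z z)) y (Y y) +
      fderiv ℝ (fun z => toBilin (W z) (X z) (Y z)) y (Z y) -
      toBilin (W y) (lieBracket ℝ X Y y) (Z y) + toBilin (W y) (lieBracket ℝ X Z y) (Y y) -
      toBilin (W y) (lieBracket ℝ Y Z y) (X y) := by
  have h0 : (fun i => (![X, Y, Z] : Fin 3 → E4 → E4) i y) = ![X y, Y y, Z y] := by
    ext i : 1
    fin_cases i <;> rfl
  have h : extDeriv W y (fun i => (![X, Y, Z] : Fin 3 → E4 → E4) i y) =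
      (∑ i : Fin 3, (-1) ^ i.val • fderiv ℝ (fun x => W x (i.removeNth
        (fun k => (![X, Y, Z] : Fin 3 → E4 → E4) k x))) y ((![X, Y, Z] : Fin 3 → E4 → E4) i y)) -
      ∑ i : Fin 2, ∑ j ∈ Finset.Ici i, (-1) ^ (i + j : ℕ) • W y (Matrix.vecCons
        (lieBracket ℝ ((![X, Y, Z] : Fin 3 → E4 → E4) i.castSucc)
          ((![X, Y, Z] : Fin 3 → E4 → E4) j.succ) y)
        (j.removeNth <| i.castSucc.removeNth
          (fun k => (![X, Y, Z] : Fin 3 → E4 → E4) k y))) :=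
    extDeriv_apply_vectorField (n := 1) (V := ![X, Y, Z]) hW (by
      intro i
      fin_cases i
      exacts [hX, hY, hZ])
  have e0 : ∀ z, (0 : Fin 3).removeNth (fun i => (![X, Y, Z] : Fin 3 → E4 → E4) i z) =
      ![Y z, Z z] := by
    intro z; ext i : 1; fin_cases i <;> rfl
  have e1 : ∀ z, (1 : Fin 3).removeNth (fun i => (![X, Y, Z] : Fin 3 → E4 → E4) i z) =
      ![X z, Z z] := by
    intro z; ext i : 1; fin_cases i <;> rfl
  have e2 : ∀ z, (2 : Fin 3).removeNth (fun i => (![X, Y, Z] : Fin 3 → E4 → E4) i z) =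
      ![X z, Y z] := by
    intro z; ext i : 1; fin_cases i <;> rfl
  have f0 : (0 : Fin 2).removeNth ![Y y, Z y] = ![Z y] := by
    ext i : 1; fin_cases i; rfl
  have f1 : (1 : Fin 2).removeNth ![Y y, Z y] = ![Y y] := by
    ext i : 1; fin_cases i; rfl
  have f2 : (1 : Fin 2).removeNth ![X y, Z y] = ![X y] := by
    ext i : 1; fin_cases i; rfl
  have k0 : (Finset.Ici (0 : Fin 2)) = {0, 1} := by decide
  have k1 : (Finset.Ici (1 : Fin 2)) = {1} := by decide
  have c1 : Fin.castSucc (1 : Fin 2) = 1 := rfl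
  have c0 : Fin.castSucc (0 : Fin 2) = 0 := rfl
  have d1 : Fin.succ (1 : Fin 2) = 2 := rfl
  have d0 : Fin.succ (0 : Fin 2) = 1 := rfl
  rw [← h0, h]
  rw [Fin.sum_univ_three, Fin.sum_univ_two, k0, k1, Finset.sum_pair (by decide),
    Finset.sum_singleton]
  simp only [toBilin_apply, c0, c1, d0, d1, e0, e1, e2, f0, f1, f2]
  simp
  ring

end Calculus

end NullFF
end

noncomputable section

namespace NullFF

open VectorField

/-! ### Force-free null fields in coordinates -/

section Coordinate

variable {G : E4 → E4 →L[ℝ] E4 →L[ℝ] ℝ} {F : E4 → E4 [⋀^Fin 2]→L[ℝ] ℝ} {y : E4}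

/-- The kernel of a closed `2`-form is involutive. -/
theorem toBilin_lieBracket_eq_zero {X Y : E4 → E4} (hF : DifferentiableAt ℝ F y)
    (hX : DifferentiableAt ℝ X y) (hY : DifferentiableAt ℝ Y y)
    (hXk : ∀ᶠ z in 𝓝 y, ∀ v, toBilin (F z) (X z) v = 0)
    (hYk : ∀ᶠ z in 𝓝 y, ∀ v, toBilin (F z) (Y z) v = 0) (hd : extDeriv F y = 0) (v : E4) :
    toBilin (F y) (lieBracket ℝ X Y y) v = 0 := by
  -- With the constant field `v` as third argument, every term of `dF(X, Y, v)` except `F([X, Y],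
  -- v)` has `X` or `Y` in a slot of `F`.
  have h := extDeriv_two_apply hF hX hY (differentiableAt_const v)
  have e1 : (fun z => toBilin (F z) (Y z) v) =ᶠ[𝓝 y] fun _ => 0 := hYk.mono fun z hz => hz v
  have e2 : (fun z => toBilin (F z) (X z) v) =ᶠ[𝓝 y] fun _ => 0 := hXk.mono fun z hz => hz v
  have e3 : (fun z => toBilin (F z) (X z) (Y z)) =ᶠ[𝓝 y] fun _ => 0 := hXk.mono fun z hz => hz _
  rw [hd, e1.fderiv_eq, e2.fderiv_eq, e3.fderiv_eq, toBilin_swap _ _ (Y y), toBilin_swap _ _ (X y),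
    hXk.self_of_nhds, hYk.self_of_nhds] at h
  simpa using h

theorem differentiableAt_toBilin (hF : DifferentiableAt ℝ F y) :
    DifferentiableAt ℝ (fun z => toBilin (F z)) y :=
  (contDiff_toBilin.differentiable one_ne_zero _).comp y hF

theorem differentiableAt_sharp (hG : DifferentiableAt ℝ G y) (hB : IsLorentz (G y))
    (i : Fin 4) : DifferentiableAt ℝ (fun z => raisedVec (G z) i) y := by
  have h : DifferentiableAt ℝ (fun z => (G z).inverse) y :=
    (hB.isInvertible.contDiffAt_map_inverse (n := 1)).differentiableAt one_ne_zero |>.comp y hG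
  exact h.clm_apply (differentiableAt_const _)

theorem IsLorentz.det_gramMatrix_ne_zero {B : E4 →L[ℝ] E4 →L[ℝ] ℝ} (hB : IsLorentz B) :
    (gramMatrix B).det ≠ 0 := by
  obtain ⟨b, hb⟩ := hB.signature
  intro h
  have h1 := det_apply_apply B b b
  rw [h, zero_mul] at h1
  have h2 : (Matrix.of fun i j => B (b i) (b j)) =
      Matrix.diagonal fun i : Fin 4 => if i = 0 then (-1 : ℝ) else 1 := by
    ext i j
    simp [hb, Matrix.diagonal_apply]
  rw [h2, Matrix.det_diagonal] at h1
  simp at h1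

/-- Since `det g ≠ 0`, the factor `√|det g|` is differentiable; the rest is algebraic in `F` and the
inverse metric. -/
theorem differentiableAt_hodge2 (hG : DifferentiableAt ℝ G y) (hB : IsLorentz (G y))
    (hF : DifferentiableAt ℝ F y) : DifferentiableAt ℝ (fun z => hodge2 (G z) (F z)) y := by
  have hent : ∀ i j, DifferentiableAt ℝ (fun z => gramMatrix (G z) i j) y := fun i j =>
    (hG.clm_apply (differentiableAt_const _)).clm_apply (differentiableAt_const _)
  have hdet : DifferentiableAt ℝ (fun z => (gramMatrix (G z)).det) y := by
    simp only [Matrix.det_apply]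
    refine DifferentiableAt.fun_sum fun σ _ => DifferentiableAt.const_smul ?_ _
    exact (HasFDerivAt.finsetProd (u := Finset.univ)
      (g := fun i z => gramMatrix (G z) (σ i) i)
      fun i _ => (hent (σ i) i).hasFDerivAt).differentiableAt
  have hr : DifferentiableAt ℝ (fun z => √|(gramMatrix (G z)).det|) y := by
    refine DifferentiableAt.sqrt ?_ (abs_ne_zero.2 hB.det_gramMatrix_ne_zero)
    exact hdet.abs hB.det_gramMatrix_ne_zero
  have hw : ∀ i j, DifferentiableAt ℝ
      (fun z => F z ![raisedVec (G z) i, raisedVec (G z) j]) y := by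
    intro i j
    simp only [← toBilin_apply]
    exact ((differentiableAt_toBilin hF).clm_apply
      (differentiableAt_sharp hG hB i)).clm_apply (differentiableAt_sharp hG hB j)
  have hv : ∀ i j z, ((volForm (G z)).curryLeft (basisVec i)).curryLeft (basisVec j) =
      √|(gramMatrix (G z)).det| • (coordDet.curryLeft (basisVec i)).curryLeft (basisVec j) :=
    fun i j z => rfl
  simp only [hodge2, hv]
  refine DifferentiableAt.fun_const_smul (DifferentiableAt.fun_sum fun i _ =>
    DifferentiableAt.fun_sum fun j _ => ?_) _
  exact (hw i j).smul (hr.smul (differentiableAt_const _))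

/-- A force-free null field near `y` in coordinates, with a null frame adapted to its kernel. -/
structure AdaptedAt (G : E4 → E4 →L[ℝ] E4 →L[ℝ] ℝ) (F : E4 → E4 [⋀^Fin 2]→L[ℝ] ℝ)
    (s l a n : E4 → E4) (y : E4) : Prop where
  diff_G : DifferentiableAt ℝ G y
  diff_F : DifferentiableAt ℝ F y
  diff_s : DifferentiableAt ℝ s y
  diff_l : DifferentiableAt ℝ l y
  diff_a : DifferentiableAt ℝ a y
  diff_n : DifferentiableAt ℝ n y
  lorentz : ∀ᶠ z in 𝓝 y, IsLorentz (G z)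
  frame : ∀ᶠ z in 𝓝 y, IsNullFrame (G z) (s z) (l z) (a z) (n z)
  ker_s : ∀ᶠ z in 𝓝 y, ∀ v, toBilin (F z) (s z) v = 0
  ker_l : ∀ᶠ z in 𝓝 y, ∀ v, toBilin (F z) (l z) v = 0
  ne_zero : F y ≠ 0
  closed : extDeriv F y = 0
  force_free : ∀ v, toBilin (F y) (sharp (G y) (current G F y)) v = 0

/-- A `2`-form with kernel spanned by `s`, `l` is a multiple of `l♭ ∧ a♭`. -/
theorem IsNullFrame.toBilin_eq {B : E4 →L[ℝ] E4 →L[ℝ] ℝ} (hB : IsLorentz B) {s l a n : E4}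
    (h : IsNullFrame B s l a n) {w : E4 [⋀^Fin 2]→L[ℝ] ℝ} (hs : ∀ v, toBilin w s v = 0)
    (hl : ∀ v, toBilin w l v = 0) (x y : E4) :
    toBilin w x y = toBilin w a n * (B l x * B a y - B l y * B a x) := by
  have hs' : ∀ v, toBilin w v s = 0 := fun v => by rw [toBilin_swap, hs, neg_zero]
  have hl' : ∀ v, toBilin w v l = 0 := fun v => by rw [toBilin_swap, hl, neg_zero]
  conv_lhs => rw [h.expand hB x, h.expand hB y]
  simp only [map_add, map_sub, map_smul, add_apply, sub_apply, smul_apply, hs, hl, hs', hl',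
    toBilin_self, toBilin_swap w n a, smul_eq_mul]
  ring

/-- The consequences of `dW(u, l, ·) = 0` for a form `W` which is a multiple of `l♭ ∧ u♭`. -/
theorem lieBracket_of_extDeriv {W : E4 → E4 [⋀^Fin 2]→L[ℝ] ℝ} {u l v n : E4 → E4}
    (hW : DifferentiableAt ℝ W y) (hu : DifferentiableAt ℝ u y) (hl : DifferentiableAt ℝ l y)
    (hv : DifferentiableAt ℝ v y) (hn : DifferentiableAt ℝ n y)
    (hfr : IsNullFrame (G y) (u y) (l y) (v y) (n y)) (hB : IsLorentz (G y))
    (hWl : ∀ᶠ z in 𝓝 y, ∀ x, toBilin (W z) (l z) x = 0)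
    (hWv : ∀ᶠ z in 𝓝 y, ∀ x, toBilin (W z) (v z) x = 0)
    (h1 : extDeriv W y ![u y, l y, v y] = 0) (h2 : extDeriv W y ![u y, l y, n y] = 0)
    (h0 : toBilin (W y) (u y) (n y) ≠ 0) :
    G y (l y) (lieBracket ℝ l v y) = 0 ∧
      G y (u y) (lieBracket ℝ u l y) + G y (l y) (lieBracket ℝ l n y) =
        -fderiv ℝ (fun z => toBilin (W z) (u z) (n z)) y (l y) /
          toBilin (W y) (u y) (n y) := by
  have hWl' : ∀ᶠ z in 𝓝 y, ∀ x, toBilin (W z) x (l z) = 0 :=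
    hWl.mono fun z hz x => by rw [toBilin_swap, hz, neg_zero]
  have hWv' : ∀ᶠ z in 𝓝 y, ∀ x, toBilin (W z) x (v z) = 0 :=
    hWv.mono fun z hz x => by rw [toBilin_swap, hz, neg_zero]
  have hzero : ∀ {f : E4 → ℝ}, (∀ᶠ z in 𝓝 y, f z = 0) → fderiv ℝ f y = 0 := fun {f} hf => by
    have : f =ᶠ[𝓝 y] fun _ => 0 := hf
    rw [this.fderiv_eq]
    simp
  -- Since `l` and `v` lie in the kernel of `W`, only the `n`-component of `x`, namely `-g(l, x)`,
  -- pairs with `u`; likewise only the `u`-component pairs with `n` below.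
  have hWu : ∀ x, toBilin (W y) x (u y) = G y (l y) x * toBilin (W y) (u y) (n y) := by
    intro x
    conv_lhs => rw [hfr.expand hB x]
    simp only [map_add, map_sub, map_smul, add_apply, sub_apply, smul_apply, hWl.self_of_nhds,
      hWv.self_of_nhds, toBilin_self, toBilin_swap _ (n y), smul_eq_mul]
    ring
  have hWn : ∀ x, toBilin (W y) x (n y) = G y (u y) x * toBilin (W y) (u y) (n y) := by
    intro x
    conv_lhs => rw [hfr.expand hB x]
    simp only [map_add, map_sub, map_smul, add_apply, sub_apply, smul_apply, hWl.self_of_nhds,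
      hWv.self_of_nhds, toBilin_self, smul_eq_mul]
    ring
  -- In `dW(u, l, v)` only `-W([l, v], u)` survives. In `dW(u, l, n)` there remain `-l(W(u, n))`,
  -- `-W([u, l], n)` and `-W([l, n], u)`.
  rw [extDeriv_two_apply hW hu hl hv, hzero (hWl.mono fun z hz => hz _),
    hzero (hWv'.mono fun z hz => hz _), hzero (hWl'.mono fun z hz => hz _), hWv'.self_of_nhds,
    hWl'.self_of_nhds, hWu] at h1
  rw [extDeriv_two_apply hW hu hl hn, hzero (hWl.mono fun z hz => hz _),
    hzero (hWl'.mono fun z hz => hz _), hWl'.self_of_nhds, hWu, hWn] at h2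
  simp only [zero_apply, sub_zero, add_zero, zero_sub] at h1 h2
  refine ⟨?_, ?_⟩
  · have := neg_eq_zero.1 h1
    exact (mul_eq_zero.1 this).resolve_right h0
  · rw [eq_div_iff h0]
    linear_combination -h2

/-! ### Bracket identities, geodesics and equipartition in an adapted frame -/

namespace AdaptedAt

variable {s l a n : E4 → E4}

theorem frame' (h : AdaptedAt G F s l a n y) : IsNullFrame (G y) (s y) (l y) (a y) (n y) :=
  h.frame.self_of_nhds

theorem lorentz' (h : AdaptedAt G F s l a n y) : IsLorentz (G y) := h.lorentz.self_of_nhds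

/-- The frame with the roles of `s` and `a` exchanged. -/
theorem frame_swap (h : AdaptedAt G F s l a n y) :
    IsNullFrame (G y) (a y) (l y) (s y) (n y) where
  ss := h.frame'.aa
  aa := h.frame'.ss
  ll := h.frame'.ll
  nn := h.frame'.nn
  ln := h.frame'.ln
  ls := h.frame'.la
  la := h.frame'.ls
  sa := by rw [h.lorentz'.symm, h.frame'.sa]
  ns := h.frame'.na
  na := h.frame'.ns

theorem toBilin_ne_zero (h : AdaptedAt G F s l a n y) : toBilin (F y) (a y) (n y) ≠ 0 := by
  intro h0
  refine h.ne_zero ?_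
  ext v
  have := h.frame'.toBilin_eq h.lorentz' h.ker_s.self_of_nhds h.ker_l.self_of_nhds (v 0) (v 1)
  rw [h0, zero_mul, toBilin_apply] at this
  have hv : v = ![v 0, v 1] := by
    ext i : 1
    fin_cases i <;> rfl
  rw [hv, this]
  rfl

/-- The star of `φ l♭ ∧ a♭` contracts the volume form with `l` and `a`. These two vectors therefore
lie in the kernel of `*F`, where `a` takes the place that `s` has for `F`. -/
theorem hodge2_eq (h : AdaptedAt G F s l a n y) : ∀ᶠ z in 𝓝 y, ∀ v w,
    toBilin (hodge2 (G z) (F z)) v w =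
      toBilin (F z) (a z) (n z) * volForm (G z) ![l z, a z, v, w] := by
  filter_upwards [h.lorentz, h.frame, h.ker_s, h.ker_l] with z hB hfr hs hl v w
  rw [toBilin_apply]
  exact hB.hodge2_apply (fun x y => by rw [← toBilin_apply]; exact hfr.toBilin_eq hB hs hl x y) v w

theorem volForm_self_left (B : E4 →L[ℝ] E4 →L[ℝ] ℝ) (x y z : E4) :
    volForm B ![x, y, x, z] = 0 ∧ volForm B ![x, y, y, z] = 0 :=
  ⟨(volForm B).map_eq_zero_of_eq _ (i := 0) (j := 2) rfl (by decide),
    (volForm B).map_eq_zero_of_eq _ (i := 1) (j := 2) rfl (by decide)⟩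

theorem hodge2_l (h : AdaptedAt G F s l a n y) :
    ∀ᶠ z in 𝓝 y, ∀ v, toBilin (hodge2 (G z) (F z)) (l z) v = 0 :=
  h.hodge2_eq.mono fun z hz v => by rw [hz, (volForm_self_left _ _ _ _).1, mul_zero]

theorem hodge2_a (h : AdaptedAt G F s l a n y) :
    ∀ᶠ z in 𝓝 y, ∀ v, toBilin (hodge2 (G z) (F z)) (a z) v = 0 :=
  h.hodge2_eq.mono fun z hz v => by rw [hz, (volForm_self_left _ _ _ _).2, mul_zero]

/-- The two functions differ by the factor `volForm` of the frame, which is `±1`; squaring removes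
the orientation. -/
theorem hodge2_sn_sq (h : AdaptedAt G F s l a n y) :
    ∀ᶠ z in 𝓝 y, toBilin (hodge2 (G z) (F z)) (s z) (n z) ^ 2 =
      toBilin (F z) (a z) (n z) ^ 2 := by
  filter_upwards [h.hodge2_eq, h.lorentz, h.frame] with z hz hB hfr
  have h1 : volForm (G z) ![l z, a z, s z, n z] = volForm (G z) ![s z, l z, a z, n z] := by
    have e1 := (volForm (G z)).map_swap ![l z, a z, s z, n z] (i := 1) (j := 2) (by decide)
    have e2 := (volForm (G z)).map_swap ![l z, s z, a z, n z] (i := 0) (j := 1) (by decide)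
    have f1 : ![l z, a z, s z, n z] ∘ Equiv.swap (1 : Fin 4) 2 = ![l z, s z, a z, n z] := by
      ext i : 1
      fin_cases i <;> rfl
    have f2 : ![l z, s z, a z, n z] ∘ Equiv.swap (0 : Fin 4) 1 = ![s z, l z, a z, n z] := by
      ext i : 1
      fin_cases i <;> rfl
    rw [f1] at e1
    rw [f2, e1, neg_neg] at e2
    exact e2.symm
  rw [hz, h1, mul_pow, hfr.volForm_sq hB, mul_one]

/-- The force-free condition: `d * F (s, l, ·) = 0`. -/
theorem extDeriv_hodge2 (h : AdaptedAt G F s l a n y) :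
    extDeriv (fun z => hodge2 (G z) (F z)) y ![s y, l y, a y] = 0 ∧
      extDeriv (fun z => hodge2 (G z) (F z)) y ![s y, l y, n y] = 0 := by
  have hB := h.lorentz'
  have hfr := h.frame'
  set η := extDeriv (fun z => hodge2 (G z) (F z)) y
  set j := sharp (G y) (current G F y) with hj
  have hc : volForm (G y) ![s y, l y, a y, n y] ≠ 0 := fun h0 => by
    have := hfr.volForm_sq hB
    rw [h0] at this
    norm_num at this
  have hjB : ∀ x, G y j x = hodge3 (G y) η fun _ => x := fun x => by
    rw [hj, hB.apply_sharp]
    rfl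
  have hk := hfr.toBilin_eq hB h.ker_s.self_of_nhds h.ker_l.self_of_nhds
  have hne := h.toBilin_ne_zero
  -- As `F = φ l♭ ∧ a♭` with `φ ≠ 0`, testing `F(j, ·) = 0` on `n` yields `g(a, j) = 0`, and testing
  -- on `a` yields `g(l, j) = 0`.
  have h1 := h.force_free (n y)
  have h2 := h.force_free (a y)
  rw [hk, hB.symm (a y) (n y), hfr.na, hfr.ln] at h1
  rw [hk, hfr.aa, hfr.la] at h2
  have hl : G y j (l y) = 0 := by
    rw [hB.symm]
    simpa [hne] using h2
  have ha : G y j (a y) = 0 := by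
    rw [hB.symm]
    simpa [hne] using h1
  rw [hjB, hfr.hodge3_snd hB] at hl
  rw [hjB, hfr.hodge3_trd hB] at ha
  exact ⟨(mul_eq_zero.1 hl).resolve_left hc, (mul_eq_zero.1 ha).resolve_left hc⟩

/-- Logarithmic derivatives of `χ² = φ²` along `l`; the unknown sign relating `χ` and `φ` drops out.
-/
theorem fderiv_log_eq (h : AdaptedAt G F s l a n y) :
    -fderiv ℝ (fun z => toBilin (hodge2 (G z) (F z)) (s z) (n z)) y (l y) /
        toBilin (hodge2 (G y) (F y)) (s y) (n y) =
      -fderiv ℝ (fun z => toBilin (F z) (a z) (n z)) y (l y) / toBilin (F y) (a y) (n y) := by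
  have hφ : DifferentiableAt ℝ (fun z => toBilin (F z) (a z) (n z)) y :=
    ((differentiableAt_toBilin h.diff_F).clm_apply h.diff_a).clm_apply h.diff_n
  have hχ : DifferentiableAt ℝ (fun z => toBilin (hodge2 (G z) (F z)) (s z) (n z)) y :=
    ((differentiableAt_toBilin (differentiableAt_hodge2 h.diff_G h.lorentz'
      h.diff_F)).clm_apply h.diff_s).clm_apply h.diff_n
  have hsq := h.hodge2_sn_sq
  have hne := h.toBilin_ne_zero
  have hsq0 := hsq.self_of_nhds
  have hd : fderiv ℝ (fun z => toBilin (hodge2 (G z) (F z)) (s z) (n z) ^ 2) y =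
      fderiv ℝ (fun z => toBilin (F z) (a z) (n z) ^ 2) y :=
    Filter.EventuallyEq.fderiv_eq hsq
  rw [fderiv_fun_pow _ hφ, fderiv_fun_pow _ hχ] at hd
  have hd' := congrArg (fun L => L (l y)) hd
  simp only [smul_apply, smul_eq_mul] at hd'
  have hne' : toBilin (hodge2 (G y) (F y)) (s y) (n y) ≠ 0 := fun h0 => by
    rw [h0] at hsq0
    exact hne (pow_eq_zero_iff two_ne_zero |>.1 (by rw [← hsq0]; norm_num))
  rw [neg_div, neg_div, neg_inj, div_eq_div_iff hne' hne]
  refine mul_left_cancel₀ (mul_ne_zero hne' hne) ?_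
  simp only [nsmul_eq_mul] at hd'
  norm_num at hd'
  linear_combination (1 / 2) * toBilin (F y) (a y) (n y) ^ 2 * hd' -
    toBilin (F y) (a y) (n y) * fderiv ℝ (fun z => toBilin (F z) (a z) (n z)) y (l y) * hsq0

/-- `lieBracket_of_extDeriv` is applied to `F` with `(u, v) = (a, s)` and to `*F` with `(u, v) = (s,
a)`. In the difference of the two resulting equations both `g(l, [l, n])` and the logarithmic
derivatives cancel. -/
theorem lieBracket_eq (h : AdaptedAt G F s l a n y) :
    G y (l y) (lieBracket ℝ l s y) = 0 ∧ G y (l y) (lieBracket ℝ l a y) = 0 ∧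
      G y (s y) (lieBracket ℝ s l y) = G y (a y) (lieBracket ℝ a l y) := by
  have hne := h.toBilin_ne_zero
  have hsq0 := h.hodge2_sn_sq.self_of_nhds
  have hne' : toBilin (hodge2 (G y) (F y)) (s y) (n y) ≠ 0 := fun h0 => by
    rw [h0] at hsq0
    exact hne (pow_eq_zero_iff two_ne_zero |>.1 (by rw [← hsq0]; norm_num))
  have hF := lieBracket_of_extDeriv (G := G) h.diff_F h.diff_a h.diff_l h.diff_s h.diff_n
    h.frame_swap h.lorentz' h.ker_l h.ker_s (by rw [h.closed]; rfl) (by rw [h.closed]; rfl) hne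
  have hS := lieBracket_of_extDeriv (G := G) (differentiableAt_hodge2 h.diff_G h.lorentz' h.diff_F)
    h.diff_s h.diff_l h.diff_a h.diff_n h.frame' h.lorentz' h.hodge2_l h.hodge2_a
    h.extDeriv_hodge2.1 h.extDeriv_hodge2.2 hne'
  rw [h.fderiv_log_eq] at hS
  exact ⟨hF.1, hS.1, by linarith [hF.2, hS.2]⟩

/-- Constancy of `g(l, v)` gives `g(∇_l l, v) = -g(l, ∇_l v)`. Here `∇_l v` may be replaced by `[l,
v]`, since `g(l, ∇_v l) = 0` for null `l`. -/
theorem apply_covDeriv_self (h : AdaptedAt G F s l a n y) {v : E4 → E4} {c : ℝ}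
    (hv : DifferentiableAt ℝ v y) (hlv : ∀ᶠ z in 𝓝 y, G z (l z) (v z) = c) :
    G y (coordCovDeriv G l l y) (v y) = -G y (l y) (lieBracket ℝ l v y) := by
  have hB := h.lorentz'
  have h1 := coordCovDeriv_metric_of_const h.diff_G h.lorentz h.diff_l hv hlv l
  have h2 := coordCovDeriv_metric_of_const h.diff_G h.lorentz h.diff_l h.diff_l
    (h.frame.mono fun z hz => hz.ll) v
  rw [coordCovDeriv_torsion h.diff_G h.lorentz, map_sub]
  rw [hB.symm (coordCovDeriv G v l y)] at h2
  linarith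

/-- `∇_l l = 0` if `g([l, n], l) = 0`. -/
theorem geodesic (h : AdaptedAt G F s l a n y) (hln : G y (l y) (lieBracket ℝ l n y) = 0) :
    coordCovDeriv G l l y = 0 := by
  have hB := h.lorentz'
  obtain ⟨h1, h2, -⟩ := h.lieBracket_eq
  refine h.frame'.eq_zero hB ?_ ?_ ?_ ?_
  · rw [hB.symm, h.apply_covDeriv_self h.diff_s (h.frame.mono fun z hz => hz.ls), h1, neg_zero]
  · have := coordCovDeriv_metric_of_const h.diff_G h.lorentz h.diff_l h.diff_l
      (h.frame.mono fun z hz => hz.ll) l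
    rw [hB.symm (coordCovDeriv G l l y)] at this
    linarith
  · rw [hB.symm, h.apply_covDeriv_self h.diff_a (h.frame.mono fun z hz => hz.la), h2, neg_zero]
  · rw [hB.symm, h.apply_covDeriv_self h.diff_n (h.frame.mono fun z hz => hz.ln), hln, neg_zero]

/-- `g(∇_s l, s) = g(∇_a l, a)`. -/
theorem equipartition (h : AdaptedAt G F s l a n y) :
    G y (coordCovDeriv G s l y) (s y) = G y (coordCovDeriv G a l y) (a y) := by
  have hB := h.lorentz'
  -- For a unit field `u` one has `g(∇_l u, u) = 0`, so `∇_u l` may be replaced by `[u, l]`.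
  have key : ∀ {u : E4 → E4}, DifferentiableAt ℝ u y → (∀ᶠ z in 𝓝 y, G z (u z) (u z) = 1) →
      G y (coordCovDeriv G u l y) (u y) = G y (u y) (lieBracket ℝ u l y) := by
    intro u hu huu
    have h1 := coordCovDeriv_metric_of_const h.diff_G h.lorentz hu hu huu l
    rw [coordCovDeriv_torsion h.diff_G h.lorentz, map_sub, hB.symm (coordCovDeriv G u l y)]
    rw [hB.symm (coordCovDeriv G l u y)] at h1
    linarith
  rw [key h.diff_s (h.frame.mono fun z hz => hz.ss), key h.diff_a (h.frame.mono fun z hz => hz.aa)]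
  exact h.lieBracket_eq.2.2

end AdaptedAt

end Coordinate

end NullFF
end

noncomputable section

namespace NullFF

open VectorField

/-! ### Null frames adapted to a null `2`-form -/

section NullForm

variable {B : E4 →L[ℝ] E4 →L[ℝ] ℝ} {w : E4 [⋀^Fin 2]→L[ℝ] ℝ}

/-- The kernel of a `2`-form. -/
def bilinKer (w : E4 [⋀^Fin 2]→L[ℝ] ℝ) : Submodule ℝ E4 :=
  LinearMap.ker (toBilin w : E4 →ₗ[ℝ] E4 →L[ℝ] ℝ)

theorem mem_bilinKer {x : E4} : x ∈ bilinKer w ↔ ∀ v, toBilin w x v = 0 := by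
  rw [bilinKer, LinearMap.mem_ker]
  exact ⟨fun h v => by simpa using congrArg (fun L => L v) h, fun h => ContinuousLinearMap.ext h⟩

/-- A `2`-form whose kernel is a plane is simple. -/
theorem exists_simple_of_finrank_ker (hw : Module.finrank ℝ (bilinKer w) = 2) :
    ∃ X Y, toBilin w X Y = 1 ∧ ∀ x y, toBilin w x y =
      toBilin w x Y * toBilin w X y - toBilin w y Y * toBilin w X x := by
  have h0 : ∃ X Y, toBilin w X Y ≠ 0 := by
    by_contra! h
    have : bilinKer w = ⊤ := Submodule.eq_top_iff'.2 fun x => mem_bilinKer.2 (h x)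
    rw [this, finrank_top] at hw
    simp at hw
  obtain ⟨X, Y₀, h0⟩ := h0
  set Y : E4 := (toBilin w X Y₀)⁻¹ • Y₀ with hY
  have h1 : toBilin w X Y = 1 := by simp [hY, h0]
  have h1' : toBilin w Y X = -1 := by rw [toBilin_swap, h1]
  refine ⟨X, Y, h1, ?_⟩
  let f : E4 →ₗ[ℝ] ℝ × ℝ :=
    ((toBilin w).flip Y : E4 →ₗ[ℝ] ℝ).prod (toBilin w X : E4 →ₗ[ℝ] ℝ)
  have hfa : ∀ x, f x = (toBilin w x Y, toBilin w X x) := fun x => rfl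
  have hf : Function.Surjective f := fun p => ⟨p.1 • X + p.2 • Y, by
    rw [hfa]
    simp [h1, toBilin_self]⟩
  have hk : Module.finrank ℝ (LinearMap.ker f) = 2 := by
    have := f.finrank_range_add_finrank_ker
    rw [LinearMap.range_eq_top.2 hf, finrank_top] at this
    simp at this
    omega
  have hle : bilinKer w ≤ LinearMap.ker f := fun x hx => by
    rw [mem_bilinKer] at hx
    rw [LinearMap.mem_ker, hfa, hx, toBilin_swap, hx]
    simp
  -- Both kernels are planes, so they coincide. The component of `x` off the span of `X`, `Y` is
  -- then in the kernel of `w`, and pairing it with `y` gives the formula.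
  have heq := Submodule.eq_of_le_of_finrank_eq hle (by rw [hw, hk])
  intro x y
  have hx : x - toBilin w x Y • X - toBilin w X x • Y ∈ bilinKer w := by
    rw [heq, LinearMap.mem_ker, hfa]
    simp [h1, toBilin_self]
  have := mem_bilinKer.1 hx y
  simp only [map_sub, map_smul, sub_apply, smul_apply, smul_eq_mul, toBilin_swap w Y y] at this
  linarith

/-- The invariant of `A♭ ∧ C♭` is twice the Gram determinant of `A`, `C`. -/
theorem fieldSq_wedge (hB : IsLorentz B) {A C : E4}
    (h : ∀ x y, toBilin w x y = B A x * B C y - B A y * B C x) :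
    fieldSq B w = 2 * (B A A * B C C - B A C ^ 2) := by
  have e1 := map_basisVec_sum (B A) A
  have e2 := map_basisVec_sum (B C) C
  have e3 := map_basisVec_sum (B A) C
  have e4 := map_basisVec_sum (B C) A
  rw [hB.symm C A] at e4
  simp only [fieldSq, ← toBilin_apply, h, hB.apply_raisedVec]
  rw [← e1, ← e2, sq]
  nth_rewrite 1 [← e3]
  rw [← e4]
  simp only [Fin.sum_univ_four]
  ring

/-- A null `2`-form whose kernel is a plane is `l♭ ∧ a♭` with `l` null and `a` a unit vector
orthogonal to `l`. -/
theorem exists_null_wedge (hB : IsLorentz B) (hw : Module.finrank ℝ (bilinKer w) = 2)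
    (hnull : fieldSq B w = 0) : ∃ l a, l ≠ 0 ∧ B l l = 0 ∧ B l a = 0 ∧ B a a = 1 ∧
      ∀ x y, toBilin w x y = B l x * B a y - B l y * B a x := by
  obtain ⟨X, Y, h1, h⟩ := exists_simple_of_finrank_ker hw
  -- A vector `u` orthogonal to `l` and not a multiple of it is spacelike; dividing it by its length
  -- and multiplying `l` by that length preserves the wedge.
  suffices H : ∃ l u, l ≠ 0 ∧ B l l = 0 ∧ B l u = 0 ∧ (∀ c : ℝ, u ≠ c • l) ∧
      ∀ x y, toBilin w x y = B l x * B u y - B l y * B u x by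
    obtain ⟨l, u, hl, hll, hlu, hu, hlw⟩ := H
    have hp := hB.pos_of_orthogonal_null hl hll hlu hu
    have hr : √(B u u) ≠ 0 := (Real.sqrt_pos.2 hp).ne'
    refine ⟨√(B u u) • l, (√(B u u))⁻¹ • u, smul_ne_zero hr hl, by simp [hll], by simp [hlu], ?_,
      fun x y => ?_⟩
    · simp only [map_smul, smul_apply, smul_eq_mul]
      rw [← mul_assoc, ← mul_inv, Real.mul_self_sqrt hp.le, inv_mul_cancel₀ hp.ne']
    · simp only [map_smul, smul_apply, smul_eq_mul, hlw]
      field_simp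
  set A := sharp B ((toBilin w).flip Y) with hA
  set C := sharp B (toBilin w X) with hC
  have hAx : ∀ x, B A x = toBilin w x Y := fun x => by rw [hA, hB.apply_sharp]; rfl
  have hCx : ∀ x, B C x = toBilin w X x := fun x => by rw [hC, hB.apply_sharp]
  have hwAC : ∀ x y, toBilin w x y = B A x * B C y - B A y * B C x := fun x y => by
    rw [hAx, hAx, hCx, hCx, h]
  have hgram : B A A * B C C - B A C ^ 2 = 0 := by
    have := fieldSq_wedge hB hwAC
    rw [hnull] at this
    linarith
  have hAX : B A X = 1 := by rw [hAx, h1]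
  have hAY : B A Y = 0 := by rw [hAx, toBilin_self]
  have hCX : B C X = 0 := by rw [hCx, toBilin_self]
  have hCY : B C Y = 1 := by rw [hCx, h1]
  -- If `A` is null, the vanishing Gram determinant forces `A ⟂ C`. Otherwise the part of `C`
  -- orthogonal to `A` is null, and its wedge with `-A` is again `A♭ ∧ C♭`.
  by_cases hAA : B A A = 0
  · refine ⟨A, C, ?_, hAA, ?_, ?_, hwAC⟩
    · rintro h
      simp [h] at hAX
    · rw [hAA] at hgram
      simpa using hgram
    · rintro c hc
      rw [hc] at hCX hCY
      simp [hAX] at hCX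
      simp [hCX] at hCY
  · have hCA : B C A = B A C := hB.symm _ _
    refine ⟨C - (B A C / B A A) • A, -A, ?_, ?_, ?_, ?_, fun x y => ?_⟩
    · intro h
      have := congrArg (fun v => B v Y) h
      simp [hAY, hCY] at this
    · simp only [map_sub, map_smul, sub_apply, smul_apply, smul_eq_mul, hCA]
      field_simp
      linarith
    · simp only [map_sub, map_smul, sub_apply, smul_apply, smul_eq_mul, map_neg, hCA]
      field_simp
      ring
    · intro c hc
      have e1 := congrArg (fun v => B v Y) hc
      have e2 := congrArg (fun v => B v X) hc
      simp [hAY, hCY] at e1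
      simp [← e1, hAX] at e2
    · rw [hwAC]
      simp only [map_sub, map_smul, sub_apply, smul_apply, smul_eq_mul, map_neg, neg_apply]
      ring

/-- The unit vector along `(w(T, ·))♯`. -/
def frameA (B : E4 →L[ℝ] E4 →L[ℝ] ℝ) (w : E4 [⋀^Fin 2]→L[ℝ] ℝ) (T : E4) : E4 :=
  (√(B (sharp B (toBilin w T)) (sharp B (toBilin w T))))⁻¹ • sharp B (toBilin w T)

/-- The null vector `l` with `w = l♭ ∧ a♭`. -/
def frameL (B : E4 →L[ℝ] E4 →L[ℝ] ℝ) (w : E4 [⋀^Fin 2]→L[ℝ] ℝ) (T : E4) : E4 :=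
  -sharp B (toBilin w (frameA B w T))

/-- The null vector in the plane of `T` and `l` with `B(l, n) = -1`. -/
def frameN (B : E4 →L[ℝ] E4 →L[ℝ] ℝ) (w : E4 [⋀^Fin 2]→L[ℝ] ℝ) (T : E4) : E4 :=
  -(B (frameL B w T) T)⁻¹ • T + ((B (frameL B w T) T)⁻¹ ^ 2 * B T T / 2) • frameL B w T

/-- The projection of `e` orthogonal to `l`, `a`, `n`. -/
def frameProj (B : E4 →L[ℝ] E4 →L[ℝ] ℝ) (w : E4 [⋀^Fin 2]→L[ℝ] ℝ) (T e : E4) : E4 :=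
  e + B (frameN B w T) e • frameL B w T + B (frameL B w T) e • frameN B w T -
    B (frameA B w T) e • frameA B w T

/-- The normalised projection of `e` orthogonal to `l`, `a`, `n`. -/
def frameS (B : E4 →L[ℝ] E4 →L[ℝ] ℝ) (w : E4 [⋀^Fin 2]→L[ℝ] ℝ) (T e : E4) : E4 :=
  (√(B (frameProj B w T e) (frameProj B w T e)))⁻¹ • frameProj B w T e

variable {T e : E4}

/-- The formulas are compared with a pointwise decomposition `w = l♭ ∧ a♭`. Since `(w(T, ·))♯ = B l
T • a - B a T • l`, `frameA` is `±a` plus a multiple of `l` and `frameL` is `±l` with the same sign,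
which does not change the wedge. The choice depends only on `T`, hence smoothly on `B` and `w`. -/
theorem frameA_frameL (hB : IsLorentz B) (hT : B T T < 0)
    (hw : Module.finrank ℝ (bilinKer w) = 2) (hnull : fieldSq B w = 0) :
    0 < B (sharp B (toBilin w T)) (sharp B (toBilin w T)) ∧
    B (frameA B w T) (frameA B w T) = 1 ∧ B (frameL B w T) (frameL B w T) = 0 ∧
    B (frameL B w T) (frameA B w T) = 0 ∧ B T (frameA B w T) = 0 ∧ B (frameL B w T) T ≠ 0 ∧
    ∀ x y, toBilin w x y =
      B (frameL B w T) x * B (frameA B w T) y - B (frameL B w T) y * B (frameA B w T) x := by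
  obtain ⟨l, a, hl, hll, hla, haa, h⟩ := exists_null_wedge hB hw hnull
  have hal : B a l = 0 := by rw [hB.symm, hla]
  have hlT := hB.null_apply_timelike_ne_zero hT hl hll
  have hE : sharp B (toBilin w T) = B l T • a - B a T • l := hB.ext fun x => by
    rw [hB.apply_sharp, h]
    simp
    ring
  have hN : B (sharp B (toBilin w T)) (sharp B (toBilin w T)) = B l T ^ 2 := by
    rw [hE]
    simp [hll, hla, hal, haa]
    ring
  have hpos : 0 < B l T ^ 2 := by positivity
  obtain ⟨r, hr, hr2, hra⟩ : ∃ r : ℝ, r * B l T ≠ 0 ∧ (r * B l T) ^ 2 = 1 ∧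
      frameA B w T = r • (B l T • a - B a T • l) := by
    refine ⟨(√(B l T ^ 2))⁻¹, ?_, ?_, ?_⟩
    · have := (Real.sqrt_pos.2 hpos).ne'
      positivity
    · rw [mul_pow, inv_pow, Real.sq_sqrt hpos.le, inv_mul_cancel₀ hpos.ne']
    · rw [frameA, hN, hE]
  have hL : frameL B w T = (r * B l T) • l := hB.ext fun x => by
    rw [frameL, hra]
    simp only [map_neg, neg_apply, hB.apply_sharp, h, map_smul, map_sub, smul_apply,
      sub_apply, smul_eq_mul, hll, hla, hal, haa]
    ring
  refine ⟨hN ▸ hpos, ?_, ?_, ?_, ?_, ?_, fun x y => ?_⟩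
  · rw [hra]
    simp only [map_smul, map_sub, smul_apply, sub_apply, smul_eq_mul, hll, hla, hal, haa]
    linear_combination hr2
  · simp [hL, hll]
  · simp [hL, hra, hla, hll]
  · rw [hra, hB.symm]
    simp only [map_smul, map_sub, smul_apply, sub_apply, smul_eq_mul]
    ring
  · simp only [hL, map_smul, smul_apply, smul_eq_mul]
    exact mul_ne_zero hr hlT
  · rw [h, hL, hra]
    simp only [map_smul, map_sub, smul_apply, sub_apply, smul_eq_mul]
    linear_combination (-(B l x * B a y - B l y * B a x)) * hr2

theorem frameN_spec (hB : IsLorentz B) (hT : B T T < 0)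
    (hw : Module.finrank ℝ (bilinKer w) = 2) (hnull : fieldSq B w = 0) :
    B (frameN B w T) (frameN B w T) = 0 ∧ B (frameL B w T) (frameN B w T) = -1 ∧
      B (frameN B w T) (frameA B w T) = 0 := by
  obtain ⟨-, -, hll, hla, hTa, hlT, -⟩ := frameA_frameL hB hT hw hnull
  have hTl := hB.symm T (frameL B w T)
  refine ⟨?_, ?_, ?_⟩ <;> rw [frameN] <;>
    simp only [map_add, map_smul, add_apply, smul_apply, smul_eq_mul, hll, hla, hTa, hTl,
      neg_smul, map_neg, neg_apply] <;> field_simp <;> ring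

theorem frameProj_spec (hB : IsLorentz B) (hT : B T T < 0)
    (hw : Module.finrank ℝ (bilinKer w) = 2) (hnull : fieldSq B w = 0) :
    B (frameL B w T) (frameProj B w T e) = 0 ∧ B (frameN B w T) (frameProj B w T e) = 0 ∧
      B (frameA B w T) (frameProj B w T e) = 0 := by
  obtain ⟨-, haa, hll, hla, -, -, -⟩ := frameA_frameL hB hT hw hnull
  obtain ⟨hnn, hln, hna⟩ := frameN_spec hB hT hw hnull
  rw [frameProj]
  refine ⟨?_, ?_, ?_⟩ <;>
  simp [haa, hll, hla, hnn, hln, hna, hB.symm (frameA B w T) (frameL B w T),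
    hB.symm (frameA B w T) (frameN B w T), hB.symm (frameN B w T) (frameL B w T)]

/-- Otherwise the three vectors `l`, `n`, `a` would span a 4-dimensional space. -/
theorem exists_frameProj_ne_zero (B : E4 →L[ℝ] E4 →L[ℝ] ℝ) (w : E4 [⋀^Fin 2]→L[ℝ] ℝ) (T : E4) :
    ∃ e, frameProj B w T e ≠ 0 := by
  by_contra! h
  have hsp : Submodule.span ℝ (Set.range ![frameL B w T, frameN B w T, frameA B w T]) = ⊤ := by
    refine Submodule.eq_top_iff'.2 fun e => ?_
    have := h e
    rw [frameProj, sub_eq_zero, add_assoc, ← eq_sub_iff_add_eq] at this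
    rw [this]
    have h0 := Submodule.subset_span (R := ℝ) (Set.mem_range_self (f :=
      ![frameL B w T, frameN B w T, frameA B w T]) 0)
    have h1 := Submodule.subset_span (R := ℝ) (Set.mem_range_self (f :=
      ![frameL B w T, frameN B w T, frameA B w T]) 1)
    have h2 := Submodule.subset_span (R := ℝ) (Set.mem_range_self (f :=
      ![frameL B w T, frameN B w T, frameA B w T]) 2)
    exact sub_mem (Submodule.smul_mem _ _ h2)
      (add_mem (Submodule.smul_mem _ _ h0) (Submodule.smul_mem _ _ h1))
  have := finrank_range_le_card (R := ℝ) ![frameL B w T, frameN B w T, frameA B w T]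
  rw [Set.finrank, hsp, finrank_top] at this
  simp at this

/-- `T` lies in the span of `l` and `n`, so the projection is orthogonal to a timelike vector. -/
theorem frameProj_pos (hB : IsLorentz B) (hT : B T T < 0)
    (hw : Module.finrank ℝ (bilinKer w) = 2) (hnull : fieldSq B w = 0)
    (he : frameProj B w T e ≠ 0) : 0 < B (frameProj B w T e) (frameProj B w T e) := by
  obtain ⟨h1, h2, -⟩ := frameProj_spec (e := e) hB hT hw hnull
  obtain ⟨-, -, -, -, -, hlT, -⟩ := frameA_frameL hB hT hw hnull
  refine hB.pos_of_orthogonal_timelike hT ?_ he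
  rw [frameN] at h2
  simpa [h1, hlT] using h2

theorem isNullFrame_frame (hB : IsLorentz B) (hT : B T T < 0)
    (hw : Module.finrank ℝ (bilinKer w) = 2) (hnull : fieldSq B w = 0)
    (he : frameProj B w T e ≠ 0) :
    IsNullFrame B (frameS B w T e) (frameL B w T) (frameA B w T) (frameN B w T) := by
  obtain ⟨-, haa, hll, hla, -, -, -⟩ := frameA_frameL hB hT hw hnull
  obtain ⟨hnn, hln, hna⟩ := frameN_spec hB hT hw hnull
  obtain ⟨h1, h2, h3⟩ := frameProj_spec (e := e) hB hT hw hnull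
  have hp := frameProj_pos hB hT hw hnull he
  refine ⟨?_, haa, hll, hnn, hln, ?_, hla, ?_, ?_, hna⟩
  · simp only [frameS, map_smul, smul_apply, smul_eq_mul]
    rw [← mul_assoc, ← mul_inv, Real.mul_self_sqrt hp.le, inv_mul_cancel₀ hp.ne']
  · simp [frameS, h1]
  · rw [hB.symm]
    simp [frameS, h3]
  · simp [frameS, h2]

theorem frame_ker (hB : IsLorentz B) (hT : B T T < 0)
    (hw : Module.finrank ℝ (bilinKer w) = 2) (hnull : fieldSq B w = 0)
    (he : frameProj B w T e ≠ 0) (v : E4) :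
    toBilin w (frameS B w T e) v = 0 ∧ toBilin w (frameL B w T) v = 0 := by
  have h := isNullFrame_frame hB hT hw hnull he
  obtain ⟨-, -, -, -, -, -, hx⟩ := frameA_frameL hB hT hw hnull
  rw [hx, hx, h.ls, h.ll, hB.symm _ (frameS B w T e), h.sa, hB.symm (frameA B w T) (frameL B w T),
    h.la]
  simp

end NullForm

/-! ### Smooth local frames and the geodesic rescaling -/

section SmoothFrame

variable {G : E4 → E4 →L[ℝ] E4 →L[ℝ] ℝ} {F : E4 → E4 [⋀^Fin 2]→L[ℝ] ℝ} {y : E4} {T e : E4}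

theorem contDiffAt_sharp {k : ℕ∞ω} {θ : E4 → E4 →L[ℝ] ℝ} (hG : ContDiffAt ℝ k G y) (hB : IsLorentz (G y))
    (hθ : ContDiffAt ℝ k θ y) : ContDiffAt ℝ k (fun z => sharp (G z) (θ z)) y := by
  have h : ContDiffAt ℝ k (fun z => (G z).inverse) y :=
    (hB.isInvertible.contDiffAt_map_inverse (n := k)).comp y hG
  exact h.clm_apply hθ

theorem contDiffAt_bilin {k : ℕ∞ω} {X Y : E4 → E4} (hG : ContDiffAt ℝ k G y)
    (hX : ContDiffAt ℝ k X y) (hY : ContDiffAt ℝ k Y y) :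
    ContDiffAt ℝ k (fun z => G z (X z) (Y z)) y :=
  (hG.clm_apply hX).clm_apply hY

theorem contDiffAt_normalize {k : ℕ∞ω} {X : E4 → E4} (hG : ContDiffAt ℝ k G y)
    (hX : ContDiffAt ℝ k X y) (h : 0 < G y (X y) (X y)) :
    ContDiffAt ℝ k (fun z => (√(G z (X z) (X z)))⁻¹ • X z) y :=
  (((contDiffAt_bilin hG hX hX).sqrt h.ne').inv (Real.sqrt_pos.2 h).ne').smul hX

theorem contDiffAt_frame {k : ℕ∞ω} (hG : ContDiffAt ℝ k G y) (hF : ContDiffAt ℝ k F y)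
    (hB : IsLorentz (G y)) (hT : G y T T < 0) (hw : Module.finrank ℝ (bilinKer (F y)) = 2)
    (hnull : fieldSq (G y) (F y) = 0) :
    ContDiffAt ℝ k (fun z => frameL (G z) (F z) T) y ∧
    ContDiffAt ℝ k (fun z => frameA (G z) (F z) T) y ∧
    ContDiffAt ℝ k (fun z => frameN (G z) (F z) T) y ∧
    ContDiffAt ℝ k (fun z => frameProj (G z) (F z) T e) y := by
  have hF' : ContDiffAt ℝ k (fun z => toBilin (F z)) y := contDiff_toBilin.contDiffAt.comp y hF
  obtain ⟨hN, -, -, -, -, hlT, -⟩ := frameA_frameL hB hT hw hnull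
  have ha : ContDiffAt ℝ k (fun z => frameA (G z) (F z) T) y :=
    contDiffAt_normalize hG (contDiffAt_sharp hG hB (hF'.clm_apply contDiffAt_const)) hN
  have hl : ContDiffAt ℝ k (fun z => frameL (G z) (F z) T) y :=
    (contDiffAt_sharp hG hB (hF'.clm_apply ha)).neg
  have hi : ContDiffAt ℝ k (fun z => (G z (frameL (G z) (F z) T) T)⁻¹) y :=
    (contDiffAt_bilin hG hl contDiffAt_const).inv hlT
  have hn : ContDiffAt ℝ k (fun z => frameN (G z) (F z) T) y :=
    (hi.neg.smul contDiffAt_const).add ((((hi.pow 2).mul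
      (contDiffAt_bilin hG contDiffAt_const contDiffAt_const)).div_const 2).smul hl)
  refine ⟨hl, ha, hn, ?_⟩
  exact ((contDiffAt_const.add ((contDiffAt_bilin hG hn contDiffAt_const).smul hl)).add
    ((contDiffAt_bilin hG hl contDiffAt_const).smul hn)).sub
    ((contDiffAt_bilin hG ha contDiffAt_const).smul ha)

/-- A null `2`-form field whose kernels are planes has a smooth adapted null frame locally. -/
theorem exists_frame (hG : ∀ᶠ z in 𝓝 y, ContDiffAt ℝ ∞ G z)
    (hF : ∀ᶠ z in 𝓝 y, ContDiffAt ℝ ∞ F z) (hB : ∀ᶠ z in 𝓝 y, IsLorentz (G z))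
    (hw : ∀ᶠ z in 𝓝 y, Module.finrank ℝ (bilinKer (F z)) = 2)
    (hnull : ∀ᶠ z in 𝓝 y, fieldSq (G z) (F z) = 0) :
    ∃ s l a n : E4 → E4, ∀ᶠ z in 𝓝 y, ContDiffAt ℝ ∞ s z ∧ ContDiffAt ℝ ∞ l z ∧
      ContDiffAt ℝ ∞ a z ∧ ContDiffAt ℝ ∞ n z ∧ IsNullFrame (G z) (s z) (l z) (a z) (n z) ∧
      ∀ v, toBilin (F z) (s z) v = 0 ∧ toBilin (F z) (l z) v = 0 := by
  -- `T` and `e` are chosen at `y` alone; the inequalities they satisfy are open, so the same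
  -- constant vectors serve nearby.
  obtain ⟨T, hT⟩ := hB.self_of_nhds.exists_timelike
  obtain ⟨e, he⟩ := exists_frameProj_ne_zero (G y) (F y) T
  have hT' : ∀ᶠ z in 𝓝 y, G z T T < 0 :=
    (contDiffAt_bilin hG.self_of_nhds contDiffAt_const contDiffAt_const).continuousAt.eventually_lt
      continuousAt_const hT
  have he' : ∀ᶠ z in 𝓝 y, frameProj (G z) (F z) T e ≠ 0 :=
    (contDiffAt_frame (e := e) hG.self_of_nhds hF.self_of_nhds hB.self_of_nhds hT hw.self_of_nhds
      hnull.self_of_nhds).2.2.2.continuousAt.eventually_ne he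
  refine ⟨fun z => frameS (G z) (F z) T e, fun z => frameL (G z) (F z) T,
    fun z => frameA (G z) (F z) T, fun z => frameN (G z) (F z) T, ?_⟩
  filter_upwards [hG, hF, hB, hw, hnull, hT', he'] with z hG hF hB hw hnull hT he
  obtain ⟨hl, ha, hn, hp⟩ := contDiffAt_frame (e := e) hG hF hB hT hw hnull
  exact ⟨contDiffAt_normalize hG hp (frameProj_pos hB hT hw hnull he), hl, ha, hn,
    isNullFrame_frame hB hT hw hnull he, frame_ker hB hT hw hnull he⟩

/-- A function that is smooth near a point agrees near it with a smooth function. -/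
theorem exists_contDiff_eventuallyEq {V W : Type*} [NormedAddCommGroup V] [InnerProductSpace ℝ V]
    [NormedAddCommGroup W] [NormedSpace ℝ W] {f : V → W} {x : V}
    (hf : ∀ᶠ z in 𝓝 x, ContDiffAt ℝ ∞ f z) : ∃ f' : V → W, ContDiff ℝ ∞ f' ∧ f' =ᶠ[𝓝 x] f := by
  obtain ⟨r, hr, hrf⟩ := Metric.eventually_nhds_iff_ball.1 hf
  let χ : ContDiffBump x := ⟨r / 4, r / 2, by positivity, by linarith⟩
  refine ⟨fun z => χ z • f z, contDiff_iff_contDiffAt.2 fun z => ?_, ?_⟩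
  · by_cases hz : z ∈ Metric.ball x r
    · exact χ.contDiff.contDiffAt.smul (hrf z hz)
    · have : ∀ᶠ z' in 𝓝 z, χ z' • f z' = 0 := by
        have hmem : (Metric.closedBall x (r / 2))ᶜ ∈ 𝓝 z :=
          Metric.isClosed_closedBall.isOpen_compl.mem_nhds fun h =>
            hz (Metric.closedBall_subset_ball (by linarith) h)
        filter_upwards [hmem] with z' hz'
        rw [χ.zero_of_le_dist (by
          rw [Set.mem_compl_iff, Metric.mem_closedBall, not_le] at hz'
          exact hz'.le), zero_smul]
      have h0 : (fun z => χ z • f z) =ᶠ[𝓝 z] fun _ => 0 := this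
      exact contDiffAt_const.congr_of_eventuallyEq h0
  · filter_upwards [χ.eventuallyEq_one] with z hz
    rw [hz]
    simp

theorem contDiffAt_lieBracket {X Y : E4 → E4} (hX : ContDiffAt ℝ ∞ X y)
    (hY : ContDiffAt ℝ ∞ Y y) : ContDiffAt ℝ ∞ (lieBracket ℝ X Y) y := by
  have h1 := hX.fderiv_right (m := ∞) (by simp)
  have h2 := hY.fderiv_right (m := ∞) (by simp)
  exact (h2.clm_apply hX).sub (h1.clm_apply hY)

/-- The bracket `[e^h l, e^{-h} n]` equals `[l, n] - l(h) n - n(h) l`; its product with `l` is `g(l,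
[l, n]) + l(h)`. -/
theorem apply_lieBracket_rescale {h : E4 → ℝ} {l n : E4 → E4} (hh : DifferentiableAt ℝ h y)
    (hl : DifferentiableAt ℝ l y) (hn : DifferentiableAt ℝ n y) (hll : G y (l y) (l y) = 0)
    (hln : G y (l y) (n y) = -1)
    (hh' : fderiv ℝ h y (l y) = -G y (l y) (lieBracket ℝ l n y)) :
    G y (Real.exp (h y) • l y) (lieBracket ℝ (fun z => Real.exp (h z) • l z)
      (fun z => Real.exp (-h z) • n z) y) = 0 := by
  have e1 := hh.hasFDerivAt.exp
  have e2 : HasFDerivAt (fun z => Real.exp (-h z)) (Real.exp (-h y) • -fderiv ℝ h y) y :=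
    hh.hasFDerivAt.neg.exp
  have d1 := e1.fun_smul hl.hasFDerivAt
  have d2 := e2.fun_smul hn.hasFDerivAt
  simp only [lieBracket_eq, d1.fderiv, d2.fderiv, map_smul, smul_apply, smul_eq_mul, add_apply,
    map_add, map_sub, ContinuousLinearMap.smulRight_apply, hll, hln, neg_apply] at hh' ⊢
  rw [hh']
  have : Real.exp (-h y) * Real.exp (h y) = 1 := by rw [← Real.exp_add]; simp
  ring

/-- The null field of an adapted frame can be rescaled so that `g(l, [l, n]) = 0`. -/
theorem exists_geodesic_frame (hG : ∀ᶠ z in 𝓝 y, ContDiffAt ℝ ∞ G z)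
    (hF : ∀ᶠ z in 𝓝 y, ContDiffAt ℝ ∞ F z) (hB : ∀ᶠ z in 𝓝 y, IsLorentz (G z))
    (hw : ∀ᶠ z in 𝓝 y, Module.finrank ℝ (bilinKer (F z)) = 2)
    (hnull : ∀ᶠ z in 𝓝 y, fieldSq (G z) (F z) = 0) :
    ∃ s l a n : E4 → E4, ∀ᶠ z in 𝓝 y, ContDiffAt ℝ ∞ s z ∧ ContDiffAt ℝ ∞ l z ∧
      ContDiffAt ℝ ∞ a z ∧ ContDiffAt ℝ ∞ n z ∧ IsNullFrame (G z) (s z) (l z) (a z) (n z) ∧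
      (∀ v, toBilin (F z) (s z) v = 0 ∧ toBilin (F z) (l z) v = 0) ∧
      G z (l z) (lieBracket ℝ l n z) = 0 := by
  obtain ⟨s, l, a, n, h⟩ := exists_frame hG hF hB hw hnull
  have hl : ∀ᶠ z in 𝓝 y, ContDiffAt ℝ ∞ l z := h.mono fun z hz => hz.2.1
  have hκ : ∀ᶠ z in 𝓝 y, ContDiffAt ℝ ∞ (fun z => -G z (l z) (lieBracket ℝ l n z)) z := by
    filter_upwards [hG, h] with z hG hz
    exact (contDiffAt_bilin hG hz.2.1 (contDiffAt_lieBracket hz.2.1 hz.2.2.2.1)).neg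
  -- The transport lemma takes globally smooth data, so `l` and the right-hand side are replaced by
  -- smooth fields with the same germ at `y`.
  obtain ⟨l', hl', hll'⟩ := exists_contDiff_eventuallyEq hl
  obtain ⟨κ, hκ', hκκ'⟩ := exists_contDiff_eventuallyEq hκ
  have h0 : l' y ≠ 0 := by
    rw [hll'.self_of_nhds]
    intro h0
    have := h.self_of_nhds.2.2.2.2.1.ln
    simp [h0] at this
  obtain ⟨ρ, hρ⟩ := SmoothFlow.exists_smooth_transport hl' hκ' h0
  refine ⟨s, fun z => Real.exp (ρ z) • l z, a, fun z => Real.exp (-ρ z) • n z, ?_⟩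
  filter_upwards [h, hρ, hll', hκκ'] with z ⟨hs, hl, ha, hn, hfr, hk⟩ ⟨hρ, hρl⟩ hll' hκκ'
  refine ⟨hs, hρ.exp.smul hl, ha, hρ.neg.exp.smul hn, ?_, fun v => ⟨(hk v).1, ?_⟩, ?_⟩
  · have : Real.exp (ρ z) * Real.exp (-ρ z) = 1 := by rw [← Real.exp_add]; simp
    refine ⟨hfr.ss, hfr.aa, ?_, ?_, ?_, ?_, ?_, hfr.sa, ?_, ?_⟩ <;>
    simp [hfr.ll, hfr.nn, hfr.ln, hfr.ls, hfr.la, hfr.ns, hfr.na]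
    linear_combination this
  · simp [(hk v).2]
  · refine apply_lieBracket_rescale (hρ.differentiableAt (by simp)) (hl.differentiableAt (by simp))
      (hn.differentiableAt (by simp)) hfr.ll hfr.ln ?_
    rw [← hκκ', ← hρl, hll']

end SmoothFrame

end NullFF
end

noncomputable section

namespace NullFF

open VectorField

/-! ### Fields on spacetime and in charts -/

section Charts

variable {M : Type*} [TopologicalSpace M] [ChartedSpace E4 M] {p : M} {y : E4}

theorem toBilin_coordForm (F : ∀ x : M, TangentSpace (𝓡 4) x [⋀^Fin 2]→L[ℝ] ℝ) (u v : E4) :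
    toBilin (coordForm F p y) u v =
      F ((extChartAt (𝓡 4) p).symm y) ![chartFrame p y u, chartFrame p y v] := by
  rw [toBilin_apply]
  change F _ _ = _
  congr 1
  ext i
  fin_cases i <;> rfl

/-- The vector field with coordinates `X` in the chart at `p`. -/
def fieldOfCoord (p : M) (X : E4 → E4) : ∀ x : M, TangentSpace (𝓡 4) x :=
  mpullback (𝓡 4) 𝓘(ℝ, E4) (extChartAt (𝓡 4) p) X

theorem covDeriv_eq (g : LorentzMetric M) (X Y : ∀ x : M, TangentSpace (𝓡 4) x) (x : M) :
    covDeriv g X Y x = fieldOfCoord x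
      (coordCovDeriv (coordBilin g.val x) (coordField X x) (coordField Y x)) x := rfl

theorem covDeriv_eq_zero {g : LorentzMetric M} {X Y : ∀ x : M, TangentSpace (𝓡 4) x} {x : M}
    (h : coordCovDeriv (coordBilin g.val x) (coordField X x) (coordField Y x)
      (extChartAt (𝓡 4) x x) = 0) : covDeriv g X Y x = 0 := by
  change (mfderiv (𝓡 4) 𝓘(ℝ, E4) (extChartAt (𝓡 4) x) x).inverse (coordCovDeriv
    (coordBilin g.val x) (coordField X x) (coordField Y x) (extChartAt (𝓡 4) x x)) = 0
  rw [h]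
  exact map_zero _

variable [IsManifold (𝓡 4) ∞ M]

theorem isInvertible_chartFrame (hy : y ∈ (extChartAt (𝓡 4) p).target) :
    (chartFrame p y).IsInvertible := by
  have h := isInvertible_mfderivWithin_extChartAt_symm (I := 𝓡 4) hy
  rwa [ModelWithCorners.range_eq_univ, mfderivWithin_univ] at h

theorem chartFrame_coordField (hy : y ∈ (extChartAt (𝓡 4) p).target)
    (X : ∀ x : M, TangentSpace (𝓡 4) x) :
    chartFrame p y (coordField X p y) = X ((extChartAt (𝓡 4) p).symm y) :=
  (isInvertible_chartFrame hy).self_apply_inverse _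

theorem coordBilin_coordField
    (g : ∀ x : M, TangentSpace (𝓡 4) x →L[ℝ] TangentSpace (𝓡 4) x →L[ℝ] ℝ)
    (hy : y ∈ (extChartAt (𝓡 4) p).target) (X Y : ∀ x : M, TangentSpace (𝓡 4) x) :
    coordBilin g p y (coordField X p y) (coordField Y p y) =
      g ((extChartAt (𝓡 4) p).symm y) (X _) (Y _) := by
  rw [← chartFrame_coordField hy X, ← chartFrame_coordField hy Y]
  rfl

theorem mem_bilinKer_coordForm (hy : y ∈ (extChartAt (𝓡 4) p).target)
    (F : ∀ x : M, TangentSpace (𝓡 4) x [⋀^Fin 2]→L[ℝ] ℝ) (u : E4) :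
    u ∈ bilinKer (coordForm F p y) ↔
      chartFrame p y u ∈ formKer F ((extChartAt (𝓡 4) p).symm y) := by
  rw [mem_bilinKer]
  simp only [toBilin_coordForm]
  refine ⟨fun h v => ?_, fun h v => h _⟩
  obtain ⟨v, rfl⟩ := (isInvertible_chartFrame hy).bijective.surjective v
  exact h v

theorem finrank_bilinKer_coordForm (hy : y ∈ (extChartAt (𝓡 4) p).target)
    (F : ∀ x : M, TangentSpace (𝓡 4) x [⋀^Fin 2]→L[ℝ] ℝ) :
    Module.finrank ℝ (bilinKer (coordForm F p y)) =
      Module.finrank ℝ (formKer F ((extChartAt (𝓡 4) p).symm y)) := by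
  obtain ⟨e, he⟩ := isInvertible_chartFrame hy
  rw [← LinearEquiv.finrank_map_eq e.toLinearEquiv]
  have h : (bilinKer (coordForm F p y)).map (e.toLinearEquiv : E4 →ₗ[ℝ] _) =
      formKer F ((extChartAt (𝓡 4) p).symm y) := by
    ext v
    refine ⟨?_, fun hv => ⟨e.symm v, ?_, e.apply_symm_apply v⟩⟩
    · rintro ⟨u, hu, rfl⟩
      have := (mem_bilinKer_coordForm hy F u).1 hu
      rwa [← he] at this
    · refine (mem_bilinKer_coordForm hy F _).2 ?_
      rw [← he]
      simpa only [ContinuousLinearEquiv.coe_coe, ContinuousLinearEquiv.apply_symm_apply] using hv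
  rw [h]

theorem isLorentz_coordBilin (g : LorentzMetric M) (hy : y ∈ (extChartAt (𝓡 4) p).target) :
    IsLorentz (coordBilin g.val p y) := by
  refine ⟨fun v w => g.symm _ _ _, ?_⟩
  obtain ⟨b, hb⟩ := g.signature ((extChartAt (𝓡 4) p).symm y)
  obtain ⟨e, he⟩ := isInvertible_chartFrame hy
  refine ⟨b.map e.symm.toLinearEquiv, fun i j => ?_⟩
  rw [← hb]
  change g.val _ (chartFrame p y (e.symm (b i))) (chartFrame p y (e.symm (b j))) = _
  rw [← he, ContinuousLinearEquiv.coe_coe, ContinuousLinearEquiv.apply_symm_apply,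
    ContinuousLinearEquiv.apply_symm_apply]

theorem contDiffAt_coordField {X : ∀ x : M, TangentSpace (𝓡 4) x} {U : Set M} (hU : IsOpen U)
    (hX : SmoothFieldOn X U) (hy : y ∈ (extChartAt (𝓡 4) p).target)
    (hyU : (extChartAt (𝓡 4) p).symm y ∈ U) : ContDiffAt ℝ ∞ (coordField X p) y := by
  have h1 := (hX _ hyU).contMDiffAt (hU.mem_nhds hyU)
  have h2 : ContMDiffAt 𝓘(ℝ, E4) (𝓡 4) ∞ (extChartAt (𝓡 4) p).symm y :=
    (contMDiffOn_extChartAt_symm p).contMDiffAt ((isOpen_extChartAt_target p).mem_nhds hy)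
  have h3 := h1.mpullback_vectorField_preimage h2 (isInvertible_chartFrame hy) (by simp)
  exact contMDiffAt_vectorSpace_iff_contDiffAt.1 h3

/-- The inverse of the differential of the chart is the differential of the inverse chart. -/
theorem fieldOfCoord_symm (hy : y ∈ (extChartAt (𝓡 4) p).target) (X : E4 → E4) :
    fieldOfCoord p X ((extChartAt (𝓡 4) p).symm y) = chartFrame p y (X y) := by
  have h1 := mfderiv_extChartAt_comp_mfderivWithin_extChartAt_symm (I := 𝓡 4) hy
  have h2 := mfderivWithin_extChartAt_symm_comp_mfderiv_extChartAt (I := 𝓡 4) hy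
  rw [ModelWithCorners.range_eq_univ, mfderivWithin_univ] at h1 h2
  change (mfderiv (𝓡 4) 𝓘(ℝ, E4) (extChartAt (𝓡 4) p) ((extChartAt (𝓡 4) p).symm y)).inverse
    (X (extChartAt (𝓡 4) p ((extChartAt (𝓡 4) p).symm y))) = _
  rw [(extChartAt (𝓡 4) p).right_inv hy, ContinuousLinearMap.inverse_eq h1 h2]
  rfl

theorem coordField_fieldOfCoord (hy : y ∈ (extChartAt (𝓡 4) p).target) (X : E4 → E4) :
    coordField (fieldOfCoord p X) p y = X y := by
  refine (isInvertible_chartFrame hy).bijective.injective ?_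
  rw [chartFrame_coordField hy, fieldOfCoord_symm hy]

theorem contMDiffAt_fieldOfCoord {X : E4 → E4} (hX : ContDiffAt ℝ ∞ X y)
    (hy : y ∈ (extChartAt (𝓡 4) p).target) :
    ContMDiffAt (𝓡 4) (𝓡 4).tangent ∞
      (fun x => (⟨x, fieldOfCoord p X x⟩ : TangentBundle (𝓡 4) M))
      ((extChartAt (𝓡 4) p).symm y) := by
  have hs := (extChartAt (𝓡 4) p).map_target hy
  have h2 : ContMDiffAt (𝓡 4) 𝓘(ℝ, E4) ∞ (extChartAt (𝓡 4) p) ((extChartAt (𝓡 4) p).symm y) :=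
    contMDiffAt_extChartAt' (by rwa [← extChartAt_source (𝓡 4)])
  have hX' : ContDiffAt ℝ ∞ X (extChartAt (𝓡 4) p ((extChartAt (𝓡 4) p).symm y)) := by
    rwa [(extChartAt (𝓡 4) p).right_inv hy]
  exact (contMDiffAt_vectorSpace_iff_contDiffAt.2 hX').mpullback_vectorField_preimage h2
    (isInvertible_mfderiv_extChartAt hs) (by simp)

/-- Naturality of the Lie bracket under pullback by the inverse chart. -/
theorem coordField_mlieBracket {X Y : ∀ x : M, TangentSpace (𝓡 4) x} {U : Set M} (hU : IsOpen U)
    (hX : SmoothFieldOn X U) (hY : SmoothFieldOn Y U) (hy : y ∈ (extChartAt (𝓡 4) p).target)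
    (hyU : (extChartAt (𝓡 4) p).symm y ∈ U) :
    coordField (mlieBracket (𝓡 4) X Y) p y =
      lieBracket ℝ (coordField X p) (coordField Y p) y := by
  have h1 := ((hX _ hyU).contMDiffAt (hU.mem_nhds hyU)).mdifferentiableAt (by simp)
  have h1' := ((hY _ hyU).contMDiffAt (hU.mem_nhds hyU)).mdifferentiableAt (by simp)
  have h2 : ContMDiffAt 𝓘(ℝ, E4) (𝓡 4) ∞ (extChartAt (𝓡 4) p).symm y :=
    (contMDiffOn_extChartAt_symm p).contMDiffAt ((isOpen_extChartAt_target p).mem_nhds hy)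
  have hM : IsManifold (𝓡 4) (minSmoothness ℝ 2) M := by
    rw [minSmoothness_of_isRCLikeNormedField]
    infer_instance
  have h3 := mpullback_mlieBracket h1 h1' h2 (by
    rw [minSmoothness_of_isRCLikeNormedField]
    exact ENat.LEInfty.out)
  rw [coordField, h3, ← mlieBracketWithin_univ, mlieBracketWithin_eq_lieBracketWithin]
  exact congrFun lieBracketWithin_univ y

/-- `covDeriv` at `x` is computed in the chart at `x`, so products with it can be read off in that
same chart. -/
theorem apply_covDeriv (g : LorentzMetric M) (X Y Z : ∀ x : M, TangentSpace (𝓡 4) x) (x : M) :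
    g.val x (covDeriv g X Y x) (Z x) = coordBilin g.val x (extChartAt (𝓡 4) x x)
      (coordCovDeriv (coordBilin g.val x) (coordField X x) (coordField Y x)
        (extChartAt (𝓡 4) x x)) (coordField Z x (extChartAt (𝓡 4) x x)) := by
  have hy := mem_extChartAt_target (I := 𝓡 4) x
  rw [covDeriv_eq]
  set C := coordCovDeriv (coordBilin g.val x) (coordField X x) (coordField Y x)
  rw [← coordField_fieldOfCoord hy C, coordBilin_coordField g.val hy,
    extChartAt_to_inv x]

end Charts

end NullFF
end

noncomputable section

namespace NullFF

open VectorField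

/-! ### Force-free null fields on spacetime -/

section Spacetime

variable {M : Type*} [TopologicalSpace M] [ChartedSpace E4 M]
  {p : M} {y : E4} {g : LorentzMetric M} {F : ∀ x : M, TangentSpace (𝓡 4) x [⋀^Fin 2]→L[ℝ] ℝ}

theorem eventually_mem_chart {U : Set M} (hU : IsOpen U)
    (hy : y ∈ (extChartAt (𝓡 4) p).target) (hyU : (extChartAt (𝓡 4) p).symm y ∈ U) :
    ∀ᶠ z in 𝓝 y, z ∈ (extChartAt (𝓡 4) p).target ∧ (extChartAt (𝓡 4) p).symm z ∈ U :=
  ((isOpen_extChartAt_target p).mem_nhds hy |> Filter.eventually_mem_set.2).and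
    ((continuousAt_extChartAt_symm'' hy).eventually (hU.mem_nhds hyU))

variable [IsManifold (𝓡 4) ∞ M]

theorem coordForm_ne_zero (hy : y ∈ (extChartAt (𝓡 4) p).target)
    (hker : ∀ x : M, Module.finrank ℝ (formKer F x) = 2) : coordForm F p y ≠ 0 := by
  intro h
  have h1 := finrank_bilinKer_coordForm hy F
  have h2 : bilinKer (coordForm F p y) = ⊤ := Submodule.eq_top_iff'.2 fun x =>
    mem_bilinKer.2 fun v => by rw [toBilin_apply, h]; rfl
  rw [h2, hker, finrank_top] at h1
  simp at h1

theorem coordField_mem_bilinKer (hy : y ∈ (extChartAt (𝓡 4) p).target)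
    (X : ∀ x : M, TangentSpace (𝓡 4) x) :
    coordField X p y ∈ bilinKer (coordForm F p y) ↔
      X ((extChartAt (𝓡 4) p).symm y) ∈ formKer F ((extChartAt (𝓡 4) p).symm y) := by
  rw [mem_bilinKer_coordForm hy, chartFrame_coordField hy]

/-- The kernel of a closed `2`-form of constant rank is involutive. -/
theorem IsForceFree.mlieBracket_mem (hF : IsForceFree g F) {U : Set M}
    {X Y : ∀ x : M, TangentSpace (𝓡 4) x} (hU : IsOpen U) (hX : SmoothFieldOn X U)
    (hY : SmoothFieldOn Y U) (h : ∀ x ∈ U, X x ∈ formKer F x ∧ Y x ∈ formKer F x) {x : M}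
    (hx : x ∈ U) : mlieBracket (𝓡 4) X Y x ∈ formKer F x := by
  obtain ⟨y, hy, hyx⟩ : ∃ y ∈ (extChartAt (𝓡 4) x).target, (extChartAt (𝓡 4) x).symm y = x :=
    ⟨_, mem_extChartAt_target x, extChartAt_to_inv x⟩
  have hyU : (extChartAt (𝓡 4) x).symm y ∈ U := by rwa [hyx]
  have hFy := (hF.smooth x).contDiffAt ((isOpen_extChartAt_target x).mem_nhds hy)
  have hev := eventually_mem_chart hU hy hyU
  have key : coordField (mlieBracket (𝓡 4) X Y) x y ∈ bilinKer (coordForm F x y) := by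
    rw [coordField_mlieBracket hU hX hY hy hyU, mem_bilinKer]
    refine toBilin_lieBracket_eq_zero (hFy.differentiableAt (by simp))
      ((contDiffAt_coordField hU hX hy hyU).differentiableAt (by simp))
      ((contDiffAt_coordField hU hY hy hyU).differentiableAt (by simp)) ?_ ?_ (hF.closed x y hy)
    · exact hev.mono fun z hz => mem_bilinKer.1 ((coordField_mem_bilinKer hz.1 X).2 (h _ hz.2).1)
    · exact hev.mono fun z hz => mem_bilinKer.1 ((coordField_mem_bilinKer hz.1 Y).2 (h _ hz.2).2)
  rw [coordField_mem_bilinKer hy, hyx] at key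
  exact key

/-- An adapted frame on spacetime is an adapted frame in every chart. -/
theorem IsAdaptedFrame.adaptedAt (hF : IsForceFree g F)
    (hker : ∀ x : M, Module.finrank ℝ (formKer F x) = 2) {U : Set M}
    {s l a n : ∀ x : M, TangentSpace (𝓡 4) x} (hU : IsOpen U)
    (h : IsAdaptedFrame g (formKer F) U s l a n) (hy : y ∈ (extChartAt (𝓡 4) p).target)
    (hyU : (extChartAt (𝓡 4) p).symm y ∈ U) :
    AdaptedAt (coordBilin g.val p) (coordForm F p) (coordField s p) (coordField l p)
      (coordField a p) (coordField n p) y := by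
  have hnhds := (isOpen_extChartAt_target (I := 𝓡 4) p).mem_nhds hy
  have hev := eventually_mem_chart hU hy hyU
  refine ⟨((g.smooth p).contDiffAt hnhds).differentiableAt (by simp),
    ((hF.smooth p).contDiffAt hnhds).differentiableAt (by simp),
    (contDiffAt_coordField hU h.smooth_s hy hyU).differentiableAt (by simp),
    (contDiffAt_coordField hU h.smooth_l hy hyU).differentiableAt (by simp),
    (contDiffAt_coordField hU h.smooth_a hy hyU).differentiableAt (by simp),
    (contDiffAt_coordField hU h.smooth_n hy hyU).differentiableAt (by simp),
    hev.mono fun z hz => isLorentz_coordBilin g hz.1, hev.mono fun z hz => ?_,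
    hev.mono fun z hz => ?_, hev.mono fun z hz => ?_, coordForm_ne_zero hy hker,
    hF.closed p y hy, fun v => ?_⟩
  · constructor <;> rw [coordBilin_coordField g.val hz.1]
    exacts [h.ss _ hz.2, h.aa _ hz.2, h.ll _ hz.2, h.nn _ hz.2, h.ln _ hz.2, h.ls _ hz.2,
      h.la _ hz.2, h.sa _ hz.2, h.ns _ hz.2, h.na _ hz.2]
  · refine mem_bilinKer.1 ((coordField_mem_bilinKer hz.1 s).2 ?_)
    rw [h.span _ hz.2]
    exact Submodule.subset_span (Set.mem_insert _ _)
  · refine mem_bilinKer.1 ((coordField_mem_bilinKer hz.1 l).2 ?_)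
    rw [h.span _ hz.2]
    exact Submodule.subset_span (Set.mem_insert_of_mem _ rfl)
  · rw [toBilin_apply]
    exact hF.force_free p y hy v

/-- In an adapted frame of a force-free null field, the null mean curvature is equally
partitioned. -/
theorem IsAdaptedFrame.nullMeanCurvature_eq (hF : IsForceFree g F)
    (hker : ∀ x : M, Module.finrank ℝ (formKer F x) = 2) {U : Set M}
    {s l a n : ∀ x : M, TangentSpace (𝓡 4) x} (hU : IsOpen U)
    (h : IsAdaptedFrame g (formKer F) U s l a n) {x : M} (hx : x ∈ U) :
    nullMeanCurvature g s l a x = g.val x (covDeriv g s l x) (s x) := by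
  have h1 := (h.adaptedAt hF hker hU (mem_extChartAt_target x)
    (by rwa [extChartAt_to_inv])).equipartition
  rw [← apply_covDeriv, ← apply_covDeriv] at h1
  rw [nullMeanCurvature, ← h1]
  ring

/-- The null field of an adapted frame with `g(l, [l, n]) = 0` is geodesic. -/
theorem IsAdaptedFrame.geodesic (hF : IsForceFree g F)
    (hker : ∀ x : M, Module.finrank ℝ (formKer F x) = 2) {U : Set M}
    {s l a n : ∀ x : M, TangentSpace (𝓡 4) x} (hU : IsOpen U)
    (h : IsAdaptedFrame g (formKer F) U s l a n) {x : M} (hx : x ∈ U)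
    (hln : g.val x (l x) (mlieBracket (𝓡 4) l n x) = 0) : covDeriv g l l x = 0 := by
  have hxU : (extChartAt (𝓡 4) x).symm (extChartAt (𝓡 4) x x) ∈ U := by rwa [extChartAt_to_inv]
  have hy := mem_extChartAt_target (I := 𝓡 4) x
  refine covDeriv_eq_zero ((h.adaptedAt hF hker hU hy hxU).geodesic ?_)
  rw [← coordField_mlieBracket hU h.smooth_l h.smooth_n hy hxU, coordBilin_coordField g.val hy,
    extChartAt_to_inv]
  exact hln

/-- A null frame whose vectors `s`, `l` lie in a plane spans that plane. -/
theorem eq_span_pair {V : Type*} [AddCommGroup V] [Module ℝ V] [TopologicalSpace V]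
    {K : Submodule ℝ V} (hK : Module.finrank ℝ K = 2) {B : V →L[ℝ] V →L[ℝ] ℝ} {s l n : V}
    (hs : s ∈ K) (hl : l ∈ K) (hss : B s s = 1) (hls : B l s = 0) (hln : B l n = -1) :
    K = Submodule.span ℝ {s, l} := by
  have hind : LinearIndependent ℝ ![s, l] := by
    rw [LinearIndependent.pair_iff]
    intro c d hcd
    have h1 := congrArg (fun v => B v s) hcd
    simp [hss, hls] at h1
    have h2 := congrArg (fun v => B v n) hcd
    simp [hln, h1] at h2
    exact ⟨h1, h2⟩
  have hfin : FiniteDimensional ℝ K := Module.finite_of_finrank_pos (by rw [hK]; norm_num)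
  have hr := finrank_span_eq_card hind
  rw [Matrix.range_cons_cons_empty] at hr
  refine (Submodule.eq_of_le_of_finrank_eq (Submodule.span_le.2 ?_) ?_).symm
  · rintro v (rfl | rfl) <;> assumption
  · rw [hr, hK]
    simp

/-- A force-free null field has local adapted frames with `g(l, [l, n]) = 0`. -/
theorem IsForceFree.exists_adaptedFrame (hF : IsForceFree g F) (hnull : IsNullField g F)
    (hker : ∀ x : M, Module.finrank ℝ (formKer F x) = 2) (p : M) :
    ∃ (U : Set M) (s l a n : ∀ x : M, TangentSpace (𝓡 4) x), IsOpen U ∧ p ∈ U ∧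
      IsAdaptedFrame g (formKer F) U s l a n ∧
      ∀ x ∈ U, g.val x (l x) (mlieBracket (𝓡 4) l n x) = 0 := by
  have hT := isOpen_extChartAt_target (I := 𝓡 4) p
  have htgt : ∀ᶠ z in 𝓝 (extChartAt (𝓡 4) p p), z ∈ (extChartAt (𝓡 4) p).target :=
    hT.mem_nhds (mem_extChartAt_target p)
  obtain ⟨s, l, a, n, h⟩ := exists_geodesic_frame (G := coordBilin g.val p) (F := coordForm F p)
    (htgt.mono fun z hz => (g.smooth p).contDiffAt (hT.mem_nhds hz))
    (htgt.mono fun z hz => (hF.smooth p).contDiffAt (hT.mem_nhds hz))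
    (htgt.mono fun z hz => isLorentz_coordBilin g hz)
    (htgt.mono fun z hz => by rw [finrank_bilinKer_coordForm hz, hker])
    (htgt.mono fun z hz => hnull p z hz)
  -- One open set of coordinates on which all frame identities hold; `U` is its preimage under the
  -- chart.
  obtain ⟨Ω, hΩ, hΩo, hpΩ⟩ := eventually_nhds_iff.1 (h.and htgt)
  set U : Set M := (extChartAt (𝓡 4) p).source ∩ extChartAt (𝓡 4) p ⁻¹' Ω with hUdef
  have hU : IsOpen U := by
    have := isOpen_extChartAt_preimage' (I := 𝓡 4) p hΩo
    exact this
  have hUy : ∀ x ∈ U, ∃ y ∈ Ω, (extChartAt (𝓡 4) p).symm y = x := fun x hx =>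
    ⟨_, hx.2, (extChartAt (𝓡 4) p).left_inv hx.1⟩
  have hsm : ∀ X : E4 → E4, (∀ y ∈ Ω, ContDiffAt ℝ ∞ X y) →
      SmoothFieldOn (fieldOfCoord p X) U := by
    intro X hX x hx
    obtain ⟨y, hy, rfl⟩ := hUy x hx
    exact (contMDiffAt_fieldOfCoord (hX y hy) (hΩ y hy).2).contMDiffWithinAt
  have hap : ∀ (X Y : E4 → E4) {c : ℝ}, (∀ y ∈ Ω, coordBilin g.val p y (X y) (Y y) = c) →
      ∀ x ∈ U, g.val x (fieldOfCoord p X x) (fieldOfCoord p Y x) = c := by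
    intro X Y c hXY x hx
    obtain ⟨y, hy, rfl⟩ := hUy x hx
    rw [← coordBilin_coordField g.val (hΩ y hy).2, coordField_fieldOfCoord (hΩ y hy).2,
      coordField_fieldOfCoord (hΩ y hy).2, hXY y hy]
  have hss := hap s s fun y hy => (hΩ y hy).1.2.2.2.2.1.ss
  have hls := hap l s fun y hy => (hΩ y hy).1.2.2.2.2.1.ls
  have hln := hap l n fun y hy => (hΩ y hy).1.2.2.2.2.1.ln
  have hfl := hsm l fun y hy => (hΩ y hy).1.2.1
  have hfn := hsm n fun y hy => (hΩ y hy).1.2.2.2.1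
  refine ⟨U, fieldOfCoord p s, fieldOfCoord p l, fieldOfCoord p a, fieldOfCoord p n, hU,
    ⟨mem_extChartAt_source p, hpΩ⟩, ⟨hsm s fun y hy => (hΩ y hy).1.1, hfl,
    hsm a fun y hy => (hΩ y hy).1.2.2.1, hfn, fun x hx => ?_, hss,
    hap a a fun y hy => (hΩ y hy).1.2.2.2.2.1.aa, hap l l fun y hy => (hΩ y hy).1.2.2.2.2.1.ll,
    hap n n fun y hy => (hΩ y hy).1.2.2.2.2.1.nn, hln, hls,
    hap l a fun y hy => (hΩ y hy).1.2.2.2.2.1.la, hap s a fun y hy => (hΩ y hy).1.2.2.2.2.1.sa,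
    hap n s fun y hy => (hΩ y hy).1.2.2.2.2.1.ns, hap n a fun y hy => (hΩ y hy).1.2.2.2.2.1.na⟩,
    fun x hx => ?_⟩
  · have hs : fieldOfCoord p s x ∈ formKer F x ∧ fieldOfCoord p l x ∈ formKer F x := by
      obtain ⟨y, hy, rfl⟩ := hUy x hx
      have ht := (hΩ y hy).2
      rw [fieldOfCoord_symm ht, fieldOfCoord_symm ht, ← mem_bilinKer_coordForm ht,
        ← mem_bilinKer_coordForm ht, mem_bilinKer, mem_bilinKer]
      exact ⟨fun v => ((hΩ y hy).1.2.2.2.2.2.1 v).1, fun v => ((hΩ y hy).1.2.2.2.2.2.1 v).2⟩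
    exact eq_span_pair (B := g.val x) (hker x) hs.1 hs.2 (hss x hx) (hls x hx) (hln x hx)
  · have hxU := hx
    obtain ⟨y, hy, rfl⟩ := hUy x hx
    have ht := (hΩ y hy).2
    -- The bracket needs agreement of fields on a neighbourhood of `y`, not only at `y`.
    have hev : ∀ X : E4 → E4, coordField (fieldOfCoord p X) p =ᶠ[𝓝 y] X := fun X =>
      (hT.mem_nhds ht |> Filter.eventually_mem_set.2).mono fun z hz => coordField_fieldOfCoord hz X
    rw [← coordBilin_coordField g.val ht, coordField_mlieBracket hU hfl hfn ht hxU,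
      (hev l).lieBracket_vectorField_eq (hev n), coordField_fieldOfCoord ht]
    exact (hΩ y hy).1.2.2.2.2.2.2

end Spacetime

end NullFF
end

/-! ### The main theorem -/

theorem mainTheorem4 {M : Type*} [TopologicalSpace M] [ChartedSpace NullFF.E4 M]
    [IsManifold (𝓡 4) ∞ M] (g : NullFF.LorentzMetric M)
    (F : ∀ x : M, TangentSpace (𝓡 4) x [⋀^Fin 2]→L[ℝ] ℝ)
    (hF : NullFF.IsForceFree g F) (hnull : NullFF.IsNullField g F)
    (hker : ∀ x : M, Module.finrank ℝ (NullFF.formKer F x) = 2) :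
    NullFF.IsNullFoliation g (NullFF.formKer F) ∧
    ∀ p : M, ∃ (U : Set M) (l : ∀ x : M, TangentSpace (𝓡 4) x), IsOpen U ∧ p ∈ U ∧
      NullFF.IsNullGeodesicField g U l ∧
      (∀ x ∈ U, l x ∈ NullFF.formKer F x) ∧
      (∀ (W : Set (EuclideanSpace ℝ (Fin 2))) (σ : EuclideanSpace ℝ (Fin 2) → M),
        NullFF.IsIntegralSurface (NullFF.formKer F) W σ →
        ∀ u ∈ W, σ u ∈ U → l (σ u) ∈ (mfderiv (𝓡 2) (𝓡 4) σ u).range) ∧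
      NullFF.AdmitsEquipartition g (NullFF.formKer F) U l := by
  refine ⟨⟨hker, fun p => ?_, fun U X Y hU hX hY h x hx => hF.mlieBracket_mem hU hX hY h hx,
    fun x => ?_⟩, fun p => ?_⟩
  · obtain ⟨U, s, l, a, n, hU, hp, h, -⟩ := hF.exists_adaptedFrame hnull hker p
    exact ⟨U, hU, hp, s, l, h.smooth_s, h.smooth_l, h.span⟩
  · obtain ⟨U, s, l, a, n, hU, hp, h, -⟩ := hF.exists_adaptedFrame hnull hker x
    -- The degenerate direction is `l`, orthogonal to both spanning vectors `s` and `l`.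
    refine ⟨l x, ?_, fun h0 => ?_, fun w hw => ?_⟩
    · rw [h.span x hp]
      exact Submodule.subset_span (Set.mem_insert_of_mem _ rfl)
    · have := h.ln x hp
      simp [h0] at this
    · rw [h.span x hp] at hw
      obtain ⟨c, d, rfl⟩ := Submodule.mem_span_pair.1 hw
      simp [h.ls x hp, h.ll x hp]
  · obtain ⟨U, s, l, a, n, hU, hp, h, hln⟩ := hF.exists_adaptedFrame hnull hker p
    have hl : ∀ x ∈ U, l x ∈ NullFF.formKer F x := fun x hx => by
      rw [h.span x hx]
      exact Submodule.subset_span (Set.mem_insert_of_mem _ rfl)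
    refine ⟨U, l, hU, hp, ⟨h.smooth_l, fun x hx h0 => ?_, h.ll, fun x hx =>
      h.geodesic hF hker hU hx (hln x hx)⟩, hl, fun W σ hσ u hu hu' => ?_, ⟨s, a, n, h⟩, ?_⟩
    · have := h.ln x hx
      simp [h0] at this
    · rw [hσ.tangent u hu]
      exact hl _ hu'
    -- The bracket identities hold for arbitrary adapted frames, so the frame that produced `l`
    -- plays no role.
    · exact fun V _ hV s a n h' x hx => h'.nullMeanCurvature_eq hF hker hV hx
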